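/- Setting. Let $M$ be a closed smooth manifold and $1\le r\le\infty$. A flow $\varphi^t:M\to M$ ($t\in\mathbb R$) of class $C^r$ (jointly in $t$ and the point), with generating vector field $X$, is called Anosov if $X$ vanishes nowhere and there are a continuous $D\varphi^t$-invariant splitting $TM=E^s\oplus\mathbb RX\oplus E^u$ and constants $C>0$, $\lambda\in(0,1)$ such that for all $t>0$ $$\|D\varphi^t v\|\le C\lambda^t\|v\|\quad(v\in E^s),\qquad \|D\varphi^{-t}v\|\le C\lambda^t\|v\|\quad(v\in E^u),$$ where the norm comes from a continuous Riemannian metric on $M$. An affine torus bundle $\mathbb T^d\to E\xrightarrow{\pi}M$ over $M$ is a smooth locally trivial fiber bundle with fiber $\mathbb T^d=\mathbb R^d/\mathbb Z^d$ and structure group $SL(d,\mathbb Z)\ltimes\mathbb T^d$ acting on $\mathbb T^d$ by the affine transformations $(A,v)x=Ax+v$. Its vertical bundle is $VE=\ker D\pi\subset TE$. A $C^r$ flow $\Phi^t:E\to E$ is called a fiberwise Anosov flow over $\varphi^t$ if $\pi\circ\Phi^t=\varphi^t\circ\pi$ for all $t\in\mathbb R$ and there are a $D\Phi^t$-invariant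 splitting $VE=V^s\oplus V^u$ and constants $C>0$, $\lambda\in(0,1)$ such that for all $t>0$ $$\|D\Phi^t v\|\le C\lambda^t\|v\|\quad(v\in V^s),\qquad \|D\Phi^{-t}v\|\le C\lambda^t\|v\|\quad(v\in V^u),$$ where the norm comes from a continuous Riemannian metric on $E$. Proposition 2.4. Let $\mathbb T^d\to E\xrightarrow{\pi}M$ be an affine torus bundle over a closed smooth manifold $M$, let $1\le r\le\infty$, let $\varphi^t:M\to M$ be an Anosov flow of class $C^r$, and let $\Phi^t:E\to E$ be a $C^r$ fiberwise Anosov flow over $\varphi^t$. Then $\Phi^t$ is an Anosov flow of class $C^r$ on the total space $E$. -/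

import Mathlib

open Set Topology
open Bundle (RiemannianBundle Trivialization)
open scoped Manifold ContDiff Bundle

noncomputable section

/-! ### Flows and subbundles of the tangent bundle -/

section Anosov

variable {F : Type*} [NormedAddCommGroup F] [NormedSpace ℝ F]
  {H : Type*} [TopologicalSpace H] (I : ModelWithCorners ℝ F H)
  {M : Type*} [TopologicalSpace M] [ChartedSpace H M]

/-- The flow `φ` is of class `C^r`, jointly in time and space. -/
def IsSmoothFlow (r : ℕ∞) (φ : Flow ℝ M) : Prop :=
  ContMDiff (𝓘(ℝ, ℝ).prod I) I r (fun q : ℝ × M => φ q.1 q.2)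

/-- The vector field generating a flow: `X x` is the velocity at time `0` of `t ↦ φ t x`. -/
def flowGenerator (φ : Flow ℝ M) (x : M) : TangentSpace I x :=
  mfderiv 𝓘(ℝ, ℝ) I (fun t : ℝ => φ t x) 0 (1 : ℝ)

/-- A field `D` of subspaces of the tangent spaces is invariant under the derivative of `φ`. -/
def IsInvariantField (φ : Flow ℝ M) (D : ∀ x : M, Submodule ℝ (TangentSpace I x)) : Prop :=
  ∀ (t : ℝ) (x : M), (D x).map (mfderiv I I (φ t) x).toLinearMap = D (φ t x)

/-- A field `D` of subspaces of the tangent spaces is a continuous subbundle of the tangent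
bundle: near every point it is spanned by a continuous frame. -/
def IsContinuousSubbundle [IsManifold I 1 M]
    (D : ∀ x : M, Submodule ℝ (TangentSpace I x)) : Prop :=
  ∀ x₀ : M, ∃ U ∈ 𝓝 x₀, ∃ (k : ℕ) (s : Fin k → ∀ x : M, TangentSpace I x),
    (∀ i, ContinuousOn (fun x => (⟨x, s i x⟩ : TangentBundle I M)) U) ∧
    ∀ x ∈ U, LinearIndependent ℝ (fun i => s i x) ∧
      Submodule.span ℝ (range fun i => s i x) = D x

/-- `‖Dφ^t v‖ ≤ C λ^t ‖v‖` for `v ∈ Ds` and `‖Dφ^{-t} v‖ ≤ C λ^t ‖v‖` for `v ∈ Du`, for all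
`t > 0`, where the norm is that of the ambient Riemannian metric. -/
def HyperbolicEstimates [RiemannianBundle (fun x : M => TangentSpace I x)] (φ : Flow ℝ M)
    (Ds Du : ∀ x : M, Submodule ℝ (TangentSpace I x)) : Prop :=
  ∃ C > (0 : ℝ), ∃ lam ∈ Ioo (0 : ℝ) 1, ∀ t > (0 : ℝ), ∀ x : M,
    (∀ v ∈ Ds x, ‖mfderiv I I (φ t) x v‖ ≤ C * lam ^ t * ‖v‖) ∧
    (∀ v ∈ Du x, ‖mfderiv I I (φ (-t)) x v‖ ≤ C * lam ^ t * ‖v‖)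

/-- `φ` is an Anosov flow of class `C^r`: its generator vanishes nowhere, and there is a
continuous invariant splitting `TM = E^s ⊕ ℝX ⊕ E^u` such that `E^s` is exponentially contracted
in forward time and `E^u` in backward time. -/
def IsAnosovFlow [IsManifold I 1 M] [RiemannianBundle (fun x : M => TangentSpace I x)]
    (r : ℕ∞) (φ : Flow ℝ M) : Prop :=
  IsSmoothFlow I r φ ∧ (∀ x, flowGenerator I φ x ≠ 0) ∧
  ∃ Es Eu : ∀ x : M, Submodule ℝ (TangentSpace I x),
    IsContinuousSubbundle I Es ∧ IsContinuousSubbundle I Eu ∧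
    IsInvariantField I φ Es ∧ IsInvariantField I φ Eu ∧
    (∀ x, DirectSum.IsInternal ![Es x, Submodule.span ℝ {flowGenerator I φ x}, Eu x]) ∧
    HyperbolicEstimates I φ Es Eu

end Anosov

/-! ### Affine torus bundles -/

/-- The standard torus `𝕋^d = ℝ^d / ℤ^d`. -/
abbrev StdTorus (d : ℕ) : Type := Fin d → UnitAddCircle

/-- The projection `ℝ^d → 𝕋^d`. -/
def torusMk {d : ℕ} (θ : Fin d → ℝ) : StdTorus d := fun i => (θ i : UnitAddCircle)

/-- The affine transformation `z ↦ A z + v` of `𝕋^d`. -/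
def torusAffine {d : ℕ} (A : Matrix.SpecialLinearGroup (Fin d) ℤ) (v z : StdTorus d) :
    StdTorus d :=
  fun i => (∑ j, (A : Matrix (Fin d) (Fin d) ℤ) i j • z j) + v i

section TorusBundle

variable {F : Type*} [NormedAddCommGroup F] [NormedSpace ℝ F]
  {H : Type*} [TopologicalSpace H] (I : ModelWithCorners ℝ F H)
  {M : Type*} [TopologicalSpace M] [ChartedSpace H M]
  {F' : Type*} [NormedAddCommGroup F'] [NormedSpace ℝ F']
  {H' : Type*} [TopologicalSpace H'] (I' : ModelWithCorners ℝ F' H')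
  {E : Type*} [TopologicalSpace E] [ChartedSpace H' E]

/-- A local trivialization `e : p⁻¹(U) → U × 𝕋^d` is a diffeomorphism. Since the smooth
structure of `𝕋^d` is the one for which `ℝ^d → 𝕋^d` is a local diffeomorphism, and `e` is a
homeomorphism, this means that `U × ℝ^d → U × 𝕋^d → p⁻¹(U)` is a local diffeomorphism. -/
def IsSmoothTrivialization {d : ℕ} {p : E → M} (e : Trivialization (StdTorus d) p) : Prop :=
  IsLocalDiffeomorphOn (I.prod 𝓘(ℝ, Fin d → ℝ)) I' ∞
    (fun q : M × (Fin d → ℝ) => e.toOpenPartialHomeomorph.symm (q.1, torusMk q.2))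
    (e.baseSet ×ˢ univ)

/-- `p : E → M` is an affine `𝕋^d`-bundle: a smooth locally trivial bundle with fiber `𝕋^d` and
structure group `SL(d, ℤ) ⋉ 𝕋^d`, i.e., `M` is covered by the domains of smooth local
trivializations whose transition maps are, over each point, of the form `z ↦ A z + v`. (The
matrix `A` is then automatically locally constant in the base point, and `v` is smooth.) -/
def IsAffineTorusBundle (d : ℕ) (p : E → M) : Prop :=
  ContMDiff I' I ∞ p ∧
  ∃ atlas : Set (Trivialization (StdTorus d) p),
    (∀ x : M, ∃ e ∈ atlas, x ∈ e.baseSet) ∧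
    (∀ e ∈ atlas, IsSmoothTrivialization I I' e) ∧
    ∀ e ∈ atlas, ∀ e' ∈ atlas, ∀ x ∈ e.baseSet ∩ e'.baseSet,
      ∃ (A : Matrix.SpecialLinearGroup (Fin d) ℤ) (v : StdTorus d), ∀ z : StdTorus d,
        (e' (e.toOpenPartialHomeomorph.symm (x, z))).2 = torusAffine A v z

/-- The vertical space `ker Dp` at a point of the total space. -/
def verticalSpace (p : E → M) (y : E) : Submodule ℝ (TangentSpace I' y) :=
  LinearMap.ker (mfderiv I' I p y).toLinearMap

/-- `Φ` is a fiberwise Anosov flow of class `C^r` over `φ`: it fibers over `φ`, and there is an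
invariant splitting `ker Dp = V^s ⊕ V^u` of the vertical bundle such that `V^s` is exponentially
contracted in forward time and `V^u` in backward time. -/
def IsFiberwiseAnosovFlow [RiemannianBundle (fun y : E => TangentSpace I' y)]
    (r : ℕ∞) (p : E → M) (φ : Flow ℝ M) (Φ : Flow ℝ E) : Prop :=
  IsSmoothFlow I' r Φ ∧ (∀ (t : ℝ) (y : E), p (Φ t y) = φ t (p y)) ∧
  ∃ Vs Vu : ∀ y : E, Submodule ℝ (TangentSpace I' y),
    IsInvariantField I' Φ Vs ∧ IsInvariantField I' Φ Vu ∧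
    (∀ y, Disjoint (Vs y) (Vu y) ∧ Vs y ⊔ Vu y = verticalSpace I I' p y) ∧
    HyperbolicEstimates I' Φ Vs Vu

end TorusBundle

end

/-! Along each orbit the derivative of `Φ` is an extension of linear flows: the vertical part is
hyperbolic, and the quotient is the derivative of the Anosov flow `φ`. Stable and unstable spaces of
`Φ` must therefore be extensions of those of `φ` by `Vs` and `Vu`, and the generator of `Φ` is a
lift of that of `φ`. The stable space at `y` is taken to be the space of all vectors with `‖DΦ^n v‖
→ 0` along integers `n`; the unstable space is the same for reversed time.

A decaying vector projects into `Es`, because a neutral plus expanded vector cannot decay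
(`Contracts.eq_zero_of_tendsto`), and a vertical decaying vector lies in `Vs`. The main point is
that every `w ∈ Es` has a decaying lift (`exists_corrected_lift`). For each `k`, choose a lift `h k`
of `w` whose size at time `k` is comparable to `‖Dφ^k w‖`. Consecutive lifts differ by a vertical
vector `s k + u k` with `s k ∈ Vs` and `u k ∈ Vu`, each small at time `k` since the angle between
`Vs` and `Vu` is bounded below. Then `h 0 - ∑ u k` is again a lift of `w`; at time `n` it consists
of `h n`, the contracted `s k` with `k < n`, and the `u k` with `k ≥ n` carried backward, of total
size `O(n lam ^ n)`.

The constants depend only on bounds that hold on the compact total space. So the decaying vectors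
are exactly those satisfying one fixed exponential estimate, which is a closed condition on the
tangent bundle; and closed fields of subspaces forming a direct sum are continuous subbundles
(`IsClosedField.exists_frame`). -/

/-! ### Closed fields of subspaces and their continuous frames -/

section ClosedFields

open Filter

variable {B T : Type*} [TopologicalSpace B] [NormedAddCommGroup T] [NormedSpace ℝ T]

/-- A field of subspaces of a fixed vector space is closed if its total space is closed. -/
def IsClosedField (D : B → Submodule ℝ T) : Prop := IsClosed {z : B × T | z.2 ∈ D z.1}

theorem IsClosedField.mem_of_tendsto {D : B → Submodule ℝ T} (hD : IsClosedField D) {ι : Type*}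
    {l : Filter ι} [l.NeBot] {y : ι → B} {a : ι → T} {y₀ : B} {a₀ : T}
    (hy : Tendsto y l (𝓝 y₀)) (ha : Tendsto a l (𝓝 a₀)) (h : ∀ᶠ i in l, a i ∈ D (y i)) :
    a₀ ∈ D y₀ :=
  IsClosed.mem_of_tendsto (s := {z : B × T | z.2 ∈ D z.1}) hD (hy.prodMk_nhds ha) h

variable [FiniteDimensional ℝ T]

/-- If a sum of elements of two independent closed fields converges, so does each summand. -/
theorem IsClosedField.exists_tendsto {D₁ D₂ : B → Submodule ℝ T} (h₁ : IsClosedField D₁)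
    (h₂ : IsClosedField D₂) (hd : ∀ y, Disjoint (D₁ y) (D₂ y)) {ι : Type*} (l : Ultrafilter ι)
    {y : ι → B} {a b : ι → T} {y₀ : B} {v : T} (hy : Tendsto y l (𝓝 y₀))
    (ha : ∀ᶠ i in (l : Filter ι), a i ∈ D₁ (y i)) (hb : ∀ᶠ i in (l : Filter ι), b i ∈ D₂ (y i))
    (hab : Tendsto (fun i => a i + b i) l (𝓝 v)) :
    ∃ a₀ ∈ D₁ y₀, ∃ b₀ ∈ D₂ y₀, a₀ + b₀ = v ∧ Tendsto a l (𝓝 a₀) ∧ Tendsto b l (𝓝 b₀) := by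
  -- If the `a i` stay bounded, compactness gives their limit. Otherwise the normalized `a i` would
  -- converge to a unit vector common to `D₁ y₀` and `D₂ y₀`.
  by_cases hR : ∃ R : ℝ, ∀ᶠ i in (l : Filter ι), a i ∈ Metric.closedBall (0 : T) R
  · obtain ⟨R, hR⟩ := hR
    obtain ⟨a₀, -, hla⟩ := (isCompact_closedBall (0 : T) R).ultrafilter_le_nhds (l.map a)
      (le_principal_iff.2 hR)
    have hla' : Tendsto a l (𝓝 a₀) := hla
    have hlb : Tendsto b l (𝓝 (v - a₀)) := by
      simpa using hab.sub hla'
    exact ⟨a₀, h₁.mem_of_tendsto hy hla' ha, v - a₀, h₂.mem_of_tendsto hy hlb hb,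
      by abel, hla', hlb⟩
  · push Not at hR
    -- Along an ultrafilter, failing to be eventually in a ball means being eventually outside it.
    have hlarge : Tendsto (fun i => ‖a i‖) l atTop := by
      refine tendsto_atTop.2 fun R => ?_
      filter_upwards [hR R] with i hi
      simp only [Metric.mem_closedBall, dist_zero_right, not_le] at hi
      exact hi.le
    have hinv : Tendsto (fun i => ‖a i‖⁻¹) l (𝓝 0) := tendsto_inv_atTop_zero.comp hlarge
    obtain ⟨a₀, ha₀, hla⟩ := (isCompact_sphere (0 : T) 1).ultrafilter_le_nhds
      (l.map fun i => ‖a i‖⁻¹ • a i) (by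
        refine le_principal_iff.2 ?_
        change ∀ᶠ i in (l : Filter ι), ‖a i‖⁻¹ • a i ∈ Metric.sphere (0 : T) 1
        filter_upwards [hlarge.eventually_gt_atTop 0] with i hi
        simp [norm_smul, hi.ne'])
    have hla' : Tendsto (fun i => ‖a i‖⁻¹ • a i) l (𝓝 a₀) := hla
    have hlb : Tendsto (fun i => ‖a i‖⁻¹ • b i) l (𝓝 (-a₀)) := by
      have := (hinv.smul hab).sub hla'
      simpa [smul_add] using this
    have m₁ : a₀ ∈ D₁ y₀ := h₁.mem_of_tendsto hy hla' (ha.mono fun i hi => (D₁ _).smul_mem _ hi)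
    have m₂ : -a₀ ∈ D₂ y₀ := h₂.mem_of_tendsto hy hlb (hb.mono fun i hi => (D₂ _).smul_mem _ hi)
    have : a₀ = 0 := (Submodule.disjoint_def.1 (hd y₀)) a₀ m₁ (by simpa using m₂)
    simp [this] at ha₀

theorem IsClosedField.sup {D₁ D₂ : B → Submodule ℝ T} (h₁ : IsClosedField D₁)
    (h₂ : IsClosedField D₂) (hd : ∀ y, Disjoint (D₁ y) (D₂ y)) :
    IsClosedField fun y => D₁ y ⊔ D₂ y := by
  refine isClosed_iff_ultrafilter.2 fun ⟨y₀, v⟩ l hl hmem => ?_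
  -- Summands are chosen as functions on all of `B × T`, with the irrelevant value `0` off the sum,
  -- so that limits can be taken along `l`.
  have : ∀ z : B × T, ∃ a b : T, z.2 ∈ D₁ z.1 ⊔ D₂ z.1 → a ∈ D₁ z.1 ∧ b ∈ D₂ z.1 ∧ a + b = z.2 := by
    intro z
    by_cases hz : z.2 ∈ D₁ z.1 ⊔ D₂ z.1
    · obtain ⟨a, ha, b, hb, h⟩ := Submodule.mem_sup.1 hz
      exact ⟨a, b, fun _ => ⟨ha, hb, h⟩⟩
    · exact ⟨0, 0, fun h => absurd h hz⟩
  choose a b hab using this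
  have hl' : Tendsto id (l : Filter (B × T)) (𝓝 (y₀, v)) := hl
  have hev : ∀ᶠ z in (l : Filter (B × T)), z.2 ∈ D₁ z.1 ⊔ D₂ z.1 := hmem
  obtain ⟨a₀, ha₀, b₀, hb₀, h, -⟩ := h₁.exists_tendsto h₂ hd l (y := Prod.fst) (a := a) (b := b)
    (y₀ := y₀) (v := v) hl'.fst_nhds (hev.mono fun z hz => (hab z hz).1)
    (hev.mono fun z hz => (hab z hz).2.1)
    (hl'.snd_nhds.congr' (hev.mono fun z hz => (hab z hz).2.2.symm))
  exact Submodule.mem_sup.2 ⟨a₀, ha₀, b₀, hb₀, h⟩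

/-- The constant `v` is the sum of its two projections, so `IsClosedField.exists_tendsto` makes each
of them converge, and uniqueness of the decomposition at `y₀` identifies the limit. -/
theorem IsClosedField.continuous_projection {D₁ D₂ : B → Submodule ℝ T} (h₁ : IsClosedField D₁)
    (h₂ : IsClosedField D₂) (hc : ∀ y, IsCompl (D₁ y) (D₂ y)) (v : T) :
    Continuous fun y => (D₁ y).projection (D₂ y) (hc y) v := by
  refine continuous_iff_ultrafilter.2 fun y₀ l hl => ?_
  obtain ⟨a₀, ha₀, b₀, hb₀, h, hta, -⟩ := h₁.exists_tendsto h₂ (fun y => (hc y).disjoint) l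
    (y := id) (a := fun y => (D₁ y).projection (D₂ y) (hc y) v)
    (b := fun y => v - (D₁ y).projection (D₂ y) (hc y) v) (v := v) hl
    (.of_forall fun y => by simp) (.of_forall fun y => Submodule.sub_projection_mem (hc y) v)
    (by simp)
  have : (D₁ y₀).projection (D₂ y₀) (hc y₀) v = a₀ := by
    rw [← h, map_add, Submodule.projection_apply_of_mem_left _ ha₀,
      (Submodule.projection_apply_eq_zero_iff _).2 hb₀, add_zero]
  change Tendsto _ (l : Filter B) (𝓝 ((D₁ y₀).projection (D₂ y₀) (hc y₀) v))
  rwa [this]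

/-- Project a basis of `D₁ y₀` to `D₁ y` along `D₂ y`. At `y₀` this gives back the basis, and linear
independence is an open condition. -/
theorem IsClosedField.exists_independent_sections {D₁ D₂ : B → Submodule ℝ T}
    (h₁ : IsClosedField D₁) (h₂ : IsClosedField D₂) (hc : ∀ y, IsCompl (D₁ y) (D₂ y)) (y₀ : B) :
    ∃ s : Fin (Module.finrank ℝ (D₁ y₀)) → B → T, (∀ i, Continuous (s i)) ∧
      (∀ i y, s i y ∈ D₁ y) ∧ ∀ᶠ y in 𝓝 y₀, LinearIndependent ℝ fun i => s i y := by
  let b := Module.finBasis ℝ (D₁ y₀)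
  refine ⟨fun i y => (D₁ y).projection (D₂ y) (hc y) (b i),
    fun i => h₁.continuous_projection h₂ hc _, fun i y => by simp, ?_⟩
  have hcont : Continuous fun y => fun i => (D₁ y).projection (D₂ y) (hc y) (b i) :=
    continuous_pi fun i => h₁.continuous_projection h₂ hc _
  refine hcont.continuousAt.eventually (LinearIndependent.eventually ?_)
  have : (fun i => (D₁ y₀).projection (D₂ y₀) (hc y₀) (b i)) = fun i => (b i : T) := by
    funext i
    exact Submodule.projection_apply_left _ _
  beta_reduce
  rw [this]
  exact b.linearIndependent.map' (D₁ y₀).subtype (Submodule.ker_subtype _)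

/-- A closed field with a closed complement has continuous local frames. -/
theorem IsClosedField.exists_frame {D₁ D₂ : B → Submodule ℝ T}
    (h₁ : IsClosedField D₁) (h₂ : IsClosedField D₂) (hc : ∀ y, IsCompl (D₁ y) (D₂ y)) (y₀ : B) :
    ∃ (k : ℕ) (s : Fin k → B → T), (∀ i, Continuous (s i)) ∧ ∀ᶠ y in 𝓝 y₀,
      LinearIndependent ℝ (fun i => s i y) ∧ Submodule.span ℝ (range fun i => s i y) = D₁ y := by
  obtain ⟨s, hs, hsD, hsi⟩ := h₁.exists_independent_sections h₂ hc y₀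
  obtain ⟨s', -, hsD', hsi'⟩ := h₂.exists_independent_sections h₁ (fun y => (hc y).symm) y₀
  refine ⟨_, s, hs, ?_⟩
  filter_upwards [hsi, hsi'] with y hy hy'
  refine ⟨hy, Submodule.eq_of_le_of_finrank_le ?_ ?_⟩
  · rw [Submodule.span_le]
    rintro _ ⟨i, rfl⟩
    exact hsD i y
  · have hle' : Submodule.span ℝ (range fun i => s' i y) ≤ D₂ y := by
      rw [Submodule.span_le]
      rintro _ ⟨i, rfl⟩
      exact hsD' i y
    have e := finrank_span_eq_card hy
    have e' := finrank_span_eq_card hy'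
    have l' := Submodule.finrank_mono hle'
    -- Neither rank drops near `y₀`, and the two ranks always add up to `dim T`, so both are locally
    -- constant.
    have c₀ := Submodule.finrank_add_eq_of_isCompl (hc y₀)
    have c := Submodule.finrank_add_eq_of_isCompl (hc y)
    simp only [Fintype.card_fin] at e e'
    omega

end ClosedFields

/-! ### Contracted and expanded subspaces for families of seminorms -/

section Contraction

open Filter

variable {T : Type*} [AddCommGroup T] [Module ℝ T]

/-- A family of seminorms `q t` decays exponentially in `t` on a subspace, uniformly in the
initial time. -/
def Contracts (C lam : ℝ) (q : ℝ → Seminorm ℝ T) (D : Submodule ℝ T) : Prop :=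
  ∀ t τ : ℝ, 0 ≤ τ → ∀ v ∈ D, q (t + τ) v ≤ C * lam ^ τ * q t v

/-- The time reversal of a family of seminorms. -/
def timeReversal (q : ℝ → Seminorm ℝ T) : ℝ → Seminorm ℝ T := fun t => q (-t)

@[simp] theorem timeReversal_timeReversal (q : ℝ → Seminorm ℝ T) :
    timeReversal (timeReversal q) = q := by
  funext t
  simp [timeReversal]

/-- Seminorms at nearby times are comparable. -/
def Tempered (B : ℝ) (q : ℝ → Seminorm ℝ T) : Prop :=
  ∀ t τ : ℝ, |τ| ≤ 1 → ∀ v, q (t + τ) v ≤ B * q t v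

theorem Tempered.timeReversal {B : ℝ} {q : ℝ → Seminorm ℝ T} (h : Tempered B q) :
    Tempered B (timeReversal q) := fun t τ hτ v => by
  have := h (-t) (-τ) (by simpa using hτ) v
  rwa [← neg_add] at this

theorem Tempered.nat {B : ℝ} (hB : 1 ≤ B) {q : ℝ → Seminorm ℝ T} (h : Tempered B q) (t : ℝ) (n : ℕ)
    (v : T) : q (t + n) v ≤ B ^ n * q t v := by
  induction n with
  | zero => simp
  | succ n ih =>
    have := h (t + n) 1 (by simp) v
    push_cast
    rw [← add_assoc, pow_succ']
    nlinarith

variable {C lam B : ℝ} {q : ℝ → Seminorm ℝ T} {Ds Du : Submodule ℝ T}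

theorem Contracts.nat (h : Contracts C lam q Ds) (t : ℝ) (n : ℕ) {v : T} (hv : v ∈ Ds) :
    q (t + n) v ≤ C * lam ^ n * q t v := by
  simpa using h t n n.cast_nonneg v hv

theorem Contracts.nat_rev (h : Contracts C lam (timeReversal q) Du) (t : ℝ) (n : ℕ) {v : T}
    (hv : v ∈ Du) : q t v ≤ C * lam ^ n * q (t + n) v := by
  have := h.nat (-(t + n)) n hv
  simpa [timeReversal] using this

/-- The angle between exponentially contracted and expanded subspaces is bounded below. -/
theorem exists_splitting_bound (C lam B : ℝ) (hlam : lam ∈ Ioo (0 : ℝ) 1) (hB : 1 ≤ B) :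
    ∃ K ≥ (1 : ℝ), ∀ {T : Type*} [AddCommGroup T] [Module ℝ T] {q : ℝ → Seminorm ℝ T}
      {Ds Du : Submodule ℝ T}, Tempered B q → Contracts C lam q Ds →
      Contracts C lam (timeReversal q) Du → ∀ (t : ℝ), ∀ s ∈ Ds, ∀ u ∈ Du,
      q t s ≤ K * q t (s + u) ∧ q t u ≤ K * q t (s + u) := by
  -- After time `n` the stable part is at most half as large and the unstable part at least twice as
  -- large, while `s + u` has grown by at most `B ^ n`. Comparing times `t` and `t + n` excludes
  -- cancellation.
  obtain ⟨n, hn⟩ : ∃ n : ℕ, C * lam ^ n ≤ 1 / 2 := by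
    have : Tendsto (fun n : ℕ => C * lam ^ n) atTop (𝓝 (C * 0)) :=
      (tendsto_pow_atTop_nhds_zero_of_lt_one hlam.1.le hlam.2).const_mul C
    exact (this.eventually (Iic_mem_nhds (by norm_num))).exists
  have hBn : 1 ≤ B ^ n := one_le_pow₀ hB
  refine ⟨B ^ n + 2, by linarith, ?_⟩
  intro T _ _ q Ds Du hq hs hu t s hsD u huD
  have e₁ := hq.nat hB t n (s + u)
  have e₂ := hs.nat t n hsD
  have e₃ := hu.nat_rev t n huD
  have e₄ : q (t + n) u ≤ q (t + n) (s + u) + q (t + n) s := by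
    have := map_sub_le_add (q (t + n)) (s + u) s
    simpa using this
  have e₅ : q t s ≤ q t (s + u) + q t u := by
    have := map_sub_le_add (q t) (s + u) u
    simpa using this
  have p₁ := apply_nonneg (q t) s
  have p₂ := apply_nonneg (q t) u
  have p₃ := apply_nonneg (q t) (s + u)
  have p₄ := apply_nonneg (q (t + n)) u
  have e₂' : q (t + n) s ≤ 1 / 2 * q t s := e₂.trans (by gcongr)
  have e₃' : q t u ≤ 1 / 2 * q (t + n) u := e₃.trans (by gcongr)
  constructor <;> nlinarith

/-- A combination of a neutral and an expanded vector that decays is trivial. -/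
theorem Contracts.eq_zero_of_tendsto {X u : T} {c K a : ℝ} (hlam : lam ∈ Ioo (0 : ℝ) 1)
    (hu : Contracts C lam (timeReversal q) Du) (huD : u ∈ Du) (hc : 0 < c)
    (hX : ∀ t, c ≤ q t X) (hX' : ∀ t, q t X ≤ K) (hq : ∀ v, q 0 v = 0 → v = 0)
    (h : Tendsto (fun n : ℕ => q n (a • X + u)) atTop (𝓝 0)) : a = 0 ∧ u = 0 := by
  have hzero : Tendsto (fun n : ℕ => C * lam ^ n) atTop (𝓝 0) := by
    simpa using (tendsto_pow_atTop_nhds_zero_of_lt_one hlam.1.le hlam.2).const_mul C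
  have hle : ∀ n : ℕ, q 0 u ≤ |C * lam ^ n| * (q n (a • X + u) + |a| * K) := fun n => by
    have e₁ := hu.nat_rev 0 n huD
    have e₂ : q n u ≤ q n (a • X + u) + |a| * q n X := by
      have := map_sub_le_add (q n) (a • X + u) (a • X)
      simpa [map_smul_eq_mul] using this
    rw [zero_add] at e₁
    calc q 0 u ≤ C * lam ^ n * q n u := e₁
      _ ≤ |C * lam ^ n| * q n u := by gcongr; exact le_abs_self _
      _ ≤ |C * lam ^ n| * (q n (a • X + u) + |a| * K) := by
        gcongr
        exact e₂.trans (by gcongr; exact hX' n)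
  -- The neutral vector stays bounded, so `u` stays bounded in the future; backward contraction then
  -- makes it zero at time `0`.
  have hu0 : u = 0 := by
    refine hq u (le_antisymm ?_ (apply_nonneg _ _))
    refine ge_of_tendsto' (x := atTop) ?_ hle
    simpa using hzero.abs.mul (h.add_const (|a| * K))
  refine ⟨?_, hu0⟩
  subst hu0
  have : |a| * c ≤ 0 := ge_of_tendsto' h fun n => by
    rw [add_zero, map_smul_eq_mul, Real.norm_eq_abs]
    gcongr
    exact hX n
  exact abs_eq_zero.1 (le_antisymm (by nlinarith [abs_nonneg a]) (abs_nonneg a))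

end Contraction

/-! ### Decaying vectors and corrected lifts -/

section HyperbolicExtension

open Filter

section

variable {T : Type*} [AddCommGroup T] [Module ℝ T]

/-- The vectors whose seminorms tend to zero along integer times. -/
def decaying (q : ℝ → Seminorm ℝ T) : Submodule ℝ T where
  carrier := {v | Tendsto (fun n : ℕ => q n v) atTop (𝓝 0)}
  zero_mem' := by simp
  add_mem' {v w} hv hw := by
    refine squeeze_zero (fun _ => apply_nonneg _ _) (fun n => map_add_le_add (q n) v w) ?_
    simpa using Tendsto.add hv hw
  smul_mem' a v hv := by
    have := Tendsto.const_mul |a| hv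
    simpa [map_smul_eq_mul] using this

theorem Contracts.le_decaying {C lam : ℝ} (hlam : lam ∈ Ioo (0 : ℝ) 1) {q : ℝ → Seminorm ℝ T}
    {D : Submodule ℝ T} (h : Contracts C lam q D) : D ≤ decaying q := by
  intro v hv
  refine squeeze_zero (fun _ => apply_nonneg _ _)
    (fun n => by simpa using h.nat 0 n hv) (g := fun n : ℕ => C * lam ^ n * q 0 v) ?_
  simpa using ((tendsto_pow_atTop_nhds_zero_of_lt_one hlam.1.le hlam.2).const_mul C).mul_const
    (q 0 v)

end

/-- Each `mu ^ k` with `k < n` is at least `mu ^ n`, and their sum is below the full geometric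
series. This turns `n * lam ^ n` into a multiple of `mu ^ n` when `lam = mu ^ 2`. -/
theorem nat_mul_pow_le {mu : ℝ} (hmu : mu ∈ Ioo (0 : ℝ) 1) (n : ℕ) :
    n * mu ^ n ≤ 1 / (1 - mu) := by
  have h : n * mu ^ n ≤ ∑ k ∈ Finset.range n, mu ^ k := by
    rw [← nsmul_eq_mul, ← Finset.card_range n, ← Finset.sum_const]
    simp only [Finset.card_range]
    exact Finset.sum_le_sum fun k hk =>
      pow_le_pow_of_le_one hmu.1.le hmu.2.le (Finset.mem_range.1 hk).le
  refine h.trans ?_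
  have := mul_neg_geom_sum mu n
  rw [le_div_iff₀ (by linarith [hmu.2]), mul_comm, this]
  have := pow_pos hmu.1 n
  linarith

/-- The partial sums in the construction of the lift of a contracted vector. -/
theorem sum_range_correction {T : Type*} [AddCommGroup T] {h s u : ℕ → T}
    (hb : ∀ k, h k - h (k + 1) = s k + u k) (n N : ℕ) :
    h 0 - ∑ k ∈ Finset.range (n + N), u k
      = h n + ∑ k ∈ Finset.range n, s k - ∑ k ∈ Finset.range N, u (n + k) := by
  have h₁ : ∑ k ∈ Finset.range n, s k + ∑ k ∈ Finset.range n, u k = h 0 - h n := by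
    rw [← Finset.sum_add_distrib, ← Finset.sum_range_sub' h n]
    exact Finset.sum_congr rfl fun k _ => (hb k).symm
  rw [Finset.sum_range_add]
  have : h 0 = h n + ∑ k ∈ Finset.range n, s k + ∑ k ∈ Finset.range n, u k := by
    rw [add_assoc, h₁]
    abel
  rw [this]
  abel

theorem sum_pow_le {lam : ℝ} (hlam : lam ∈ Ioo (0 : ℝ) 1) (N : ℕ) :
    ∑ k ∈ Finset.range N, lam ^ k ≤ 1 / (1 - lam) := by
  have := mul_neg_geom_sum lam N
  rw [le_div_iff₀ (by linarith [hlam.2]), mul_comm, this]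
  have := pow_pos hlam.1 N
  linarith

variable {T : Type*} [NormedAddCommGroup T] [NormedSpace ℝ T] [FiniteDimensional ℝ T]

/-- Corrected lifts of contracted vectors decay: if `h k` are lifts at time `k` with differences
`s k + u k`, where `s k` and `u k` are exponentially small, then `h 0 - ∑ u k` decays. -/
theorem exists_corrected_lift {C lam mu B L : ℝ} (hC : 1 ≤ C) (hmu : mu ∈ Ioo (0 : ℝ) 1)
    (hlam : lam = mu ^ 2) (hB : 1 ≤ B) (hL : 0 ≤ L)
    {q : ℝ → Seminorm ℝ T} (hq0 : ∀ v, q 0 v = ‖v‖) (hq : Tempered B q) {Vs Vu : Submodule ℝ T}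
    (hs : Contracts C lam q Vs) (hu : Contracts C lam (timeReversal q) Vu) {h s u : ℕ → T}
    (hsV : ∀ k, s k ∈ Vs) (huV : ∀ k, u k ∈ Vu) (hb : ∀ k, h k - h (k + 1) = s k + u k)
    (hh : ∀ k : ℕ, q k (h k) ≤ L * lam ^ k) (hsL : ∀ k : ℕ, q k (s k) ≤ L * lam ^ k)
    (huL : ∀ k : ℕ, q k (u k) ≤ L * lam ^ k) :
    ∃ z ∈ Vu, ∀ n : ℕ, q n (h 0 - z) ≤ (1 + 2 * C / (1 - mu)) * L * mu ^ n := by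
  have hlam' : lam ∈ Ioo (0 : ℝ) 1 := by
    rw [hlam]
    exact ⟨pow_pos hmu.1 2, pow_lt_one₀ hmu.1.le hmu.2 two_ne_zero⟩
  have hlm : lam ≤ mu := by rw [hlam]; nlinarith [hmu.1, hmu.2]
  have h1mu : 0 < 1 - mu := by linarith [hmu.2]
  have h1lam : 0 < 1 - lam := by linarith [hlam'.2]
  -- `u (n + k)` is small at time `n + k` and shrinks further when carried back to time `n`. So the
  -- tails are geometric; the case `n = 0` gives summability.
  have hu' : ∀ n k : ℕ, q n (u (n + k)) ≤ C * L * lam ^ n * lam ^ k := fun n k => by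
    have e₁ := hu.nat_rev n k (huV (n + k))
    have e₂ := huL (n + k)
    push_cast at e₂
    have hk : lam ^ k ≤ 1 := pow_le_one₀ hlam'.1.le hlam'.2.le
    have hp : 0 < lam ^ k := pow_pos hlam'.1 k
    have hp' : 0 < lam ^ n := pow_pos hlam'.1 n
    calc q n (u (n + k)) ≤ C * lam ^ k * q (n + k) (u (n + k)) := e₁
      _ ≤ C * 1 * (L * lam ^ (n + k)) := by gcongr
      _ = C * L * lam ^ n * lam ^ k := by ring
  have hs' : ∀ n k : ℕ, k ≤ n → q n (s k) ≤ C * L * lam ^ n := fun n k hk => by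
    obtain ⟨j, rfl⟩ := Nat.exists_eq_add_of_le hk
    have e₁ := hs.nat k j (hsV k)
    have hp : 0 < lam ^ j := pow_pos hlam'.1 j
    push_cast
    calc q (k + j) (s k) ≤ C * lam ^ j * q k (s k) := e₁
      _ ≤ C * lam ^ j * (L * lam ^ k) := by gcongr; exact hsL k
      _ = C * L * lam ^ (k + j) := by ring
  have hsum : Summable u := by
    refine Summable.of_norm_bounded
      ((summable_geometric_of_lt_one hlam'.1.le hlam'.2).mul_left (C * L)) fun k => ?_
    have := hu' 0 k
    simpa [hq0] using this
  refine ⟨∑' k, u k, ?_, fun n => ?_⟩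
  · exact Vu.closed_of_finiteDimensional.mem_of_tendsto hsum.hasSum.tendsto_sum_nat
      (.of_forall fun N => Vu.sum_mem fun k _ => huV k)
  set z := ∑' k, u k
  have hz : Tendsto (fun N => ∑ k ∈ Finset.range (n + N), u k) atTop (𝓝 z) := by
    have := (tendsto_add_atTop_iff_nat n).2 hsum.hasSum.tendsto_sum_nat
    simpa [add_comm n] using this
  -- One term `1` of the constant comes from `h n`, one `C / (1 - mu)` from the `s k` with `k < n`,
  -- and one from the tail of the `u k`.
  have hpart : ∀ N, q n (h 0 - ∑ k ∈ Finset.range (n + N), u k)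
      ≤ (1 + 2 * C / (1 - mu)) * L * mu ^ n := fun N => by
    rw [sum_range_correction hb n N]
    have e₁ : q n (∑ k ∈ Finset.range n, s k) ≤ n * (C * L * lam ^ n) := by
      refine (Finset.le_sum_of_subadditive (q n) (map_zero _).le (map_add_le_add _) _ _).trans ?_
      refine (Finset.sum_le_sum fun k hk => hs' n k (Finset.mem_range.1 hk).le).trans ?_
      simp
    have e₂ : q n (∑ k ∈ Finset.range N, u (n + k)) ≤ C * L * lam ^ n * (1 / (1 - lam)) := by
      refine (Finset.le_sum_of_subadditive (q n) (map_zero _).le (map_add_le_add _) _ _).trans ?_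
      refine (Finset.sum_le_sum fun k _ => hu' n k).trans ?_
      rw [← Finset.mul_sum]
      have := pow_pos hlam'.1 n
      gcongr
      exact sum_pow_le hlam' N
    have hln : lam ^ n = mu ^ n * mu ^ n := by rw [hlam]; ring
    have hmn : 0 < mu ^ n := pow_pos hmu.1 n
    have hmn1 : mu ^ n ≤ 1 := pow_le_one₀ hmu.1.le hmu.2.le
    have hlmn : lam ^ n ≤ mu ^ n := by rw [hln]; nlinarith
    have e₁' : n * (C * L * lam ^ n) ≤ C / (1 - mu) * L * mu ^ n := by
      calc n * (C * L * lam ^ n) = C * L * mu ^ n * (n * mu ^ n) := by rw [hln]; ring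
        _ ≤ C * L * mu ^ n * (1 / (1 - mu)) := by gcongr; exact nat_mul_pow_le hmu n
        _ = _ := by ring
    have e₂' : C * L * lam ^ n * (1 / (1 - lam)) ≤ C / (1 - mu) * L * mu ^ n := by
      calc C * L * lam ^ n * (1 / (1 - lam)) ≤ C * L * mu ^ n * (1 / (1 - mu)) := by gcongr
        _ = _ := by ring
    have e₃ : q n (h n) ≤ L * mu ^ n := (hh n).trans (by gcongr)
    have t₁ := map_sub_le_add (q n) (h n + ∑ k ∈ Finset.range n, s k)
      (∑ k ∈ Finset.range N, u (n + k))
    have t₂ := map_add_le_add (q n) (h n) (∑ k ∈ Finset.range n, s k)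
    have : (1 + 2 * C / (1 - mu)) * L * mu ^ n
        = L * mu ^ n + C / (1 - mu) * L * mu ^ n + C / (1 - mu) * L * mu ^ n := by ring
    linarith
  -- The bound passes to the limit `N → ∞` because `q n` is at most `B ^ n` times the norm, hence
  -- continuous.
  have hlim : Tendsto (fun N => (1 + 2 * C / (1 - mu)) * L * mu ^ n
      + B ^ n * ‖(∑ k ∈ Finset.range (n + N), u k) - z‖) atTop
      (𝓝 ((1 + 2 * C / (1 - mu)) * L * mu ^ n + B ^ n * 0)) :=
    tendsto_const_nhds.add ((tendsto_iff_norm_sub_tendsto_zero.1 hz).const_mul _)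
  rw [mul_zero, add_zero] at hlim
  refine ge_of_tendsto' hlim fun N => ?_
  have e := hq.nat hB 0 n ((∑ k ∈ Finset.range (n + N), u k) - z)
  rw [zero_add, hq0] at e
  have t := map_add_le_add (q n) (h 0 - ∑ k ∈ Finset.range (n + N), u k)
    ((∑ k ∈ Finset.range (n + N), u k) - z)
  rw [sub_add_sub_cancel] at t
  linarith [hpart N]

variable {W : Type*} [AddCommGroup W] [Module ℝ W]

/-- A surjection `P : T → W` of vector spaces carrying tempered families of seminorms, with
hyperbolic splittings `ker P = Vs ⊕ Vu` and `W = Ws ⊕ ℝ(PX) ⊕ Wu`. -/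
structure HyperbolicExtension (C lam B K c : ℝ) (q : ℝ → Seminorm ℝ T) (m : ℝ → Seminorm ℝ W)
    (P : T →ₗ[ℝ] W) (X : T) (Vs Vu : Submodule ℝ T) (Ws Wu : Submodule ℝ W) : Prop where
  norm_eq : ∀ v, q 0 v = ‖v‖
  definite : ∀ w, m 0 w = 0 → w = 0
  tempered : Tempered B q
  ker_eq : LinearMap.ker P = Vs ⊔ Vu
  exists_lift : ∀ t w, ∃ v, P v = w ∧ q t v ≤ K * m t w
  map_le : ∀ t v, m t (P v) ≤ K * q t v
  vs : Contracts C lam q Vs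
  vu : Contracts C lam (timeReversal q) Vu
  ws : Contracts C lam m Ws
  wu : Contracts C lam (timeReversal m) Wu
  sup_eq : Ws ⊔ Submodule.span ℝ {P X} ⊔ Wu = ⊤
  le_field : ∀ t, c ≤ q t X
  field_le : ∀ t, q t X ≤ K
  le_map_field : ∀ t, c ≤ m t (P X)
  map_field_le : ∀ t, m t (P X) ≤ K

end HyperbolicExtension

/-! ### Direct sums of three subspaces -/

section InternalThree

variable {T : Type*} [AddCommGroup T] [Module ℝ T]

theorem isInternal_three {D : Fin 3 → Submodule ℝ T}
    (hind : ∀ a ∈ D 0, ∀ b ∈ D 1, ∀ c ∈ D 2, a + b + c = 0 → a = 0 ∧ b = 0 ∧ c = 0)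
    (hsup : ∀ v, ∃ a ∈ D 0, ∃ b ∈ D 1, ∃ c ∈ D 2, a + b + c = v) :
    DirectSum.IsInternal D := by
  classical
  refine ⟨(injective_iff_map_eq_zero _).2 fun x hx => ?_, fun v => ?_⟩
  · have hs : (x 0 : T) + x 1 + x 2 = 0 := by
      rw [← hx, DirectSum.coeAddMonoidHom_eq_dfinsuppSum, DFinsupp.sum_eq_sum_fintype _ (by simp)]
      simp [Fin.sum_univ_three]
    obtain ⟨h0, h1, h2⟩ := hind _ (x 0).2 _ (x 1).2 _ (x 2).2 hs
    ext i
    fin_cases i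
    · exact h0
    · exact h1
    · exact h2
  · obtain ⟨a, ha, b, hb, c, hc, rfl⟩ := hsup v
    refine ⟨DirectSum.of (fun i => D i) 0 ⟨a, ha⟩ + DirectSum.of (fun i => D i) 1 ⟨b, hb⟩
      + DirectSum.of (fun i => D i) 2 ⟨c, hc⟩, ?_⟩
    simp

theorem DirectSum.IsInternal.sup_three_eq_top {D₀ D₁ D₂ : Submodule ℝ T}
    (h : DirectSum.IsInternal ![D₀, D₁, D₂]) : D₀ ⊔ D₁ ⊔ D₂ = ⊤ := by
  rw [← top_le_iff, ← h.submodule_iSup_eq_top, iSup_le_iff]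
  intro i
  fin_cases i
  · exact le_sup_of_le_left le_sup_left
  · exact le_sup_of_le_left le_sup_right
  · exact le_sup_right

end InternalThree

/-! ### The hyperbolic splitting of an extension -/

namespace HyperbolicExtension

open Filter

variable {T : Type*} [NormedAddCommGroup T] [NormedSpace ℝ T]
  {W : Type*} [AddCommGroup W] [Module ℝ W] {C lam B K c : ℝ} {q : ℝ → Seminorm ℝ T}
  {m : ℝ → Seminorm ℝ W} {P : T →ₗ[ℝ] W} {X : T} {Vs Vu : Submodule ℝ T} {Ws Wu : Submodule ℝ W}

/-- With this symmetry every result on the stable space also serves for the unstable one, with the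
same constants. -/
theorem reverse (h : HyperbolicExtension C lam B K c q m P X Vs Vu Ws Wu) :
    HyperbolicExtension C lam B K c (timeReversal q) (timeReversal m) P X Vu Vs Wu Ws where
  norm_eq v := by simp [timeReversal, h.norm_eq]
  definite w hw := h.definite w (by simpa [timeReversal] using hw)
  tempered := h.tempered.timeReversal
  ker_eq := h.ker_eq.trans (sup_comm _ _)
  exists_lift t := h.exists_lift (-t)
  map_le t := h.map_le (-t)
  vs := h.vu
  vu := by simpa using h.vs
  ws := h.wu
  wu := by simpa using h.ws
  sup_eq := by rw [← h.sup_eq, sup_comm, sup_comm Wu, sup_assoc]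
  le_field t := h.le_field (-t)
  field_le t := h.field_le (-t)
  le_map_field t := h.le_map_field (-t)
  map_field_le t := h.map_field_le (-t)

theorem exists_add_eq (h : HyperbolicExtension C lam B K c q m P X Vs Vu Ws Wu) (w : W) :
    ∃ ws ∈ Ws, ∃ a : ℝ, ∃ wu ∈ Wu, ws + a • P X + wu = w := by
  have : w ∈ Ws ⊔ Submodule.span ℝ {P X} ⊔ Wu := by rw [h.sup_eq]; trivial
  obtain ⟨y, hy, wu, hwu, rfl⟩ := Submodule.mem_sup.1 this
  obtain ⟨ws, hws, x, hx, rfl⟩ := Submodule.mem_sup.1 hy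
  obtain ⟨a, rfl⟩ := Submodule.mem_span_singleton.1 hx
  exact ⟨ws, hws, a, wu, hwu, rfl⟩

theorem eq_zero_of_mem_base (h : HyperbolicExtension C lam B K c q m P X Vs Vu Ws Wu)
    (hlam : lam ∈ Ioo (0 : ℝ) 1) (hc : 0 < c) {a : ℝ} {wu : W} (hwu : wu ∈ Wu)
    (hd : a • P X + wu ∈ decaying m) : a = 0 ∧ wu = 0 :=
  h.wu.eq_zero_of_tendsto hlam hwu hc h.le_map_field h.map_field_le h.definite hd

theorem eq_zero_of_mem_fiber (h : HyperbolicExtension C lam B K c q m P X Vs Vu Ws Wu)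
    (hlam : lam ∈ Ioo (0 : ℝ) 1) (hc : 0 < c) {u : T} (hu : u ∈ Vu)
    (hd : u ∈ decaying q) : u = 0 := by
  refine (h.vu.eq_zero_of_tendsto (a := 0) hlam hu hc h.le_field h.field_le
    (fun v hv => ?_) (by rw [zero_smul, zero_add]; exact hd)).2
  rwa [h.norm_eq, norm_eq_zero] at hv

theorem map_mem_decaying (h : HyperbolicExtension C lam B K c q m P X Vs Vu Ws Wu) {v : T}
    (hv : v ∈ decaying q) : P v ∈ decaying m := by
  refine squeeze_zero (fun _ => apply_nonneg _ _) (fun n => h.map_le n v) ?_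
  simpa using Tendsto.const_mul K hv

/-- After subtracting the contracted component of `P v`, a neutral plus expanded vector remains that
still decays, so it vanishes. -/
theorem map_mem (h : HyperbolicExtension C lam B K c q m P X Vs Vu Ws Wu)
    (hlam : lam ∈ Ioo (0 : ℝ) 1) (hc : 0 < c) {v : T} (hv : v ∈ decaying q) : P v ∈ Ws := by
  obtain ⟨ws, hws, a, wu, hwu, e⟩ := h.exists_add_eq (P v)
  have hd : a • P X + wu ∈ decaying m := by
    have := (decaying m).sub_mem (h.map_mem_decaying hv) (h.ws.le_decaying hlam hws)
    rw [← e] at this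
    convert this using 1
    abel
  obtain ⟨rfl, rfl⟩ := h.eq_zero_of_mem_base hlam hc hwu hd
  rw [← e]
  simpa using hws

theorem mem_of_map_eq_zero (h : HyperbolicExtension C lam B K c q m P X Vs Vu Ws Wu)
    (hlam : lam ∈ Ioo (0 : ℝ) 1) (hc : 0 < c) {v : T} (hv : v ∈ decaying q) (hP : P v = 0) :
    v ∈ Vs := by
  have : v ∈ Vs ⊔ Vu := by rw [← h.ker_eq]; exact hP
  obtain ⟨s, hs, u, hu, rfl⟩ := Submodule.mem_sup.1 this
  have hd : u ∈ decaying q := by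
    have := (decaying q).sub_mem hv (h.vs.le_decaying hlam hs)
    simpa using this
  simpa [h.eq_zero_of_mem_fiber hlam hc hu hd] using hs

/-- Contracted vectors in the base have decaying lifts, with uniform estimates. -/
theorem exists_lift_bound (hC : 1 ≤ C) (hlam : lam ∈ Ioo (0 : ℝ) 1) (hB : 1 ≤ B) (hK : 1 ≤ K) :
    ∃ K' ≥ (0 : ℝ), ∃ mu ∈ Ioo (0 : ℝ) 1, lam ≤ mu ∧ ∀ {T : Type*} [NormedAddCommGroup T]
      [NormedSpace ℝ T] [FiniteDimensional ℝ T] {W : Type*} [AddCommGroup W] [Module ℝ W] {c : ℝ}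
      {q : ℝ → Seminorm ℝ T} {m : ℝ → Seminorm ℝ W} {P : T →ₗ[ℝ] W} {X : T}
      {Vs Vu : Submodule ℝ T} {Ws Wu : Submodule ℝ W},
      HyperbolicExtension C lam B K c q m P X Vs Vu Ws Wu → ∀ w ∈ Ws, ∃ v, P v = w ∧
        ∀ n : ℕ, q n v ≤ K' * m 0 w * mu ^ n := by
  obtain ⟨K₁, hK₁, hsplit⟩ := exists_splitting_bound C lam B hlam hB
  -- The slower rate leaves room for the factor `n` produced by summing the stable corrections.
  set mu := √lam
  have hmu : mu ∈ Ioo (0 : ℝ) 1 := ⟨Real.sqrt_pos.2 hlam.1, by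
    rw [Real.sqrt_lt' one_pos]; simpa using hlam.2⟩
  have hlm : lam = mu ^ 2 := (Real.sq_sqrt hlam.1.le).symm
  have h1mu : 0 < 1 - mu := by linarith [hmu.2]
  refine ⟨(1 + 2 * C / (1 - mu)) * (K₁ * (2 * B * K * C)), by positivity, mu, hmu,
    by rw [hlm]; nlinarith [hmu.1, hmu.2], ?_⟩
  intro T _ _ _ W _ _ c q m P X Vs Vu Ws Wu H w hw
  -- Each `h k` is a lift of `w` at time `0`, but its size is controlled at time `k`.
  choose h hP hh using fun k : ℕ => H.exists_lift k w
  have hm0 : 0 ≤ m 0 w := apply_nonneg _ _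
  have hmk : ∀ k : ℕ, m k w ≤ C * lam ^ k * m 0 w := fun k => by
    simpa using H.ws.nat 0 k hw
  have hlk : ∀ k : ℕ, 0 < lam ^ k := fun k => pow_pos hlam.1 k
  have hhk : ∀ k : ℕ, q k (h k) ≤ K * C * m 0 w * lam ^ k := fun k => by
    calc q k (h k) ≤ K * m k w := hh k
      _ ≤ K * (C * lam ^ k * m 0 w) := by gcongr; exact hmk k
      _ = _ := by ring
  have hmem : ∀ k, ∃ s ∈ Vs, ∃ u ∈ Vu, s + u = h k - h (k + 1) := fun k => by
    refine Submodule.mem_sup.1 ?_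
    rw [← H.ker_eq, LinearMap.mem_ker, map_sub, hP, hP, sub_self]
  choose s hs u hu hsu using hmem
  -- The factor `2` counts the two lifts; `B` is the cost of comparing `h (k + 1)` at time `k + 1`
  -- with time `k`.
  have hbk : ∀ k : ℕ, q k (s k + u k) ≤ 2 * B * K * C * m 0 w * lam ^ k := fun k => by
    rw [hsu]
    have e₁ := map_sub_le_add (q k) (h k) (h (k + 1))
    have e₂ := H.tempered (k + 1 : ℕ) (-1) (by simp) (h (k + 1))
    have e₃ := hhk (k + 1)
    have e₄ : lam ^ (k + 1) ≤ lam ^ k := pow_le_pow_of_le_one hlam.1.le hlam.2.le (by omega)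
    have e₅ : ((k + 1 : ℕ) : ℝ) + -1 = k := by push_cast; ring
    rw [e₅] at e₂
    have e₆ : q k (h (k + 1)) ≤ B * (K * C * m 0 w * lam ^ k) :=
      e₂.trans (by gcongr; exact e₃.trans (by gcongr))
    have e₇ : q k (h k) ≤ B * (K * C * m 0 w * lam ^ k) := by
      refine (hhk k).trans (le_mul_of_one_le_left ?_ hB)
      have := hlk k
      positivity
    linarith
  have hL : ∀ k : ℕ, q k (s k) ≤ K₁ * (2 * B * K * C * m 0 w) * lam ^ k ∧
      q k (u k) ≤ K₁ * (2 * B * K * C * m 0 w) * lam ^ k := fun k => by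
    have e := hsplit H.tempered H.vs H.vu k (s k) (hs k) (u k) (hu k)
    have : K₁ * q k (s k + u k) ≤ K₁ * (2 * B * K * C * m 0 w) * lam ^ k := by
      rw [mul_assoc]
      gcongr
      exact hbk k
    exact ⟨e.1.trans this, e.2.trans this⟩
  have hhL : ∀ k : ℕ, q k (h k) ≤ K₁ * (2 * B * K * C * m 0 w) * lam ^ k := fun k => by
    refine (hhk k).trans ?_
    have := hlk k
    have h1 : 1 ≤ K₁ * (2 * B) := by nlinarith
    calc K * C * m 0 w * lam ^ k ≤ K₁ * (2 * B) * (K * C * m 0 w * lam ^ k) :=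
          le_mul_of_one_le_left (by positivity) h1
      _ = _ := by ring
  obtain ⟨z, hz, hzn⟩ := exists_corrected_lift (L := K₁ * (2 * B * K * C * m 0 w)) hC hmu hlm hB
    (by positivity) H.norm_eq H.tempered H.vs H.vu hs hu (fun k => (hsu k).symm) hhL
    (fun k => (hL k).1) (fun k => (hL k).2)
  refine ⟨h 0 - z, ?_, fun n => (hzn n).trans_eq (by ring)⟩
  have : P z = 0 := by
    rw [← LinearMap.mem_ker, H.ker_eq]
    exact Submodule.mem_sup_right hz
  rw [map_sub, hP, this, sub_zero]

/-- Decaying vectors decay exponentially, with uniform estimates. -/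
theorem exists_decay_bound (hC : 1 ≤ C) (hlam : lam ∈ Ioo (0 : ℝ) 1) (hB : 1 ≤ B) (hK : 1 ≤ K)
    (hc : 0 < c) :
    ∃ K' > (0 : ℝ), ∃ mu ∈ Ioo (0 : ℝ) 1, ∀ {T : Type*} [NormedAddCommGroup T]
      [NormedSpace ℝ T] [FiniteDimensional ℝ T] {W : Type*} [AddCommGroup W] [Module ℝ W]
      {q : ℝ → Seminorm ℝ T} {m : ℝ → Seminorm ℝ W} {P : T →ₗ[ℝ] W} {X : T}
      {Vs Vu : Submodule ℝ T} {Ws Wu : Submodule ℝ W},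
      HyperbolicExtension C lam B K c q m P X Vs Vu Ws Wu → ∀ v ∈ decaying q, ∀ t > (0 : ℝ),
        q t v ≤ K' * mu ^ t * ‖v‖ := by
  obtain ⟨K₂, hK₂, mu, hmu, hlm, hlift⟩ := exists_lift_bound hC hlam hB hK
  -- `K₂ * K` bounds the decaying lift `v'` of `P v`, and `C * (1 + K₂ * K)` the remainder `v - v' ∈
  -- Vs`. The factor `B / mu` passes from integer to real times.
  refine ⟨B * (K₂ * K + C * (1 + K₂ * K)) / mu, div_pos (by positivity) hmu.1, mu, hmu, ?_⟩
  intro T _ _ _ W _ _ q m P X Vs Vu Ws Wu H v hv t ht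
  obtain ⟨v', hP, hv'⟩ := hlift H (P v) (H.map_mem hlam hc hv)
  have hm0 : m 0 (P v) ≤ K * ‖v‖ := by
    rw [← H.norm_eq]
    exact H.map_le 0 v
  have hv'n : ∀ n : ℕ, q n v' ≤ K₂ * K * ‖v‖ * mu ^ n := fun n => by
    refine (hv' n).trans ?_
    have := pow_pos hmu.1 n
    rw [mul_assoc K₂ K]
    gcongr
  have hv'd : v' ∈ decaying q := by
    refine squeeze_zero (fun _ => apply_nonneg _ _) hv'n ?_
    simpa using (tendsto_pow_atTop_nhds_zero_of_lt_one hmu.1.le hmu.2).const_mul (K₂ * K * ‖v‖)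
  have hd : v - v' ∈ Vs :=
    H.mem_of_map_eq_zero hlam hc ((decaying q).sub_mem hv hv'd) (by rw [map_sub, hP, sub_self])
  have hd0 : q 0 (v - v') ≤ (1 + K₂ * K) * ‖v‖ := by
    have e₁ := map_sub_le_add (q 0) v v'
    have e₂ := hv'n 0
    simp only [Nat.cast_zero, pow_zero, mul_one] at e₂
    rw [H.norm_eq v] at e₁
    linarith
  have hn : ∀ n : ℕ, q n v ≤ (K₂ * K + C * (1 + K₂ * K)) * ‖v‖ * mu ^ n := fun n => by
    have e₁ := H.vs.nat 0 n hd
    rw [zero_add] at e₁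
    have hl : lam ^ n ≤ mu ^ n := pow_le_pow_left₀ hlam.1.le hlm n
    have hl0 := pow_pos hlam.1 n
    have hm0 := pow_pos hmu.1 n
    have e₂ : q n (v - v') ≤ C * mu ^ n * ((1 + K₂ * K) * ‖v‖) := e₁.trans (by gcongr)
    have e₃ := map_add_le_add (q n) (v - v') v'
    rw [sub_add_cancel] at e₃
    have e₄ := hv'n n
    have : (K₂ * K + C * (1 + K₂ * K)) * ‖v‖ * mu ^ n
      = K₂ * K * ‖v‖ * mu ^ n + C * mu ^ n * ((1 + K₂ * K) * ‖v‖) := by ring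
    linarith
  have e₁ := H.tempered ⌊t⌋₊ (t - ⌊t⌋₊) (by
    have := Nat.floor_le ht.le
    have := Nat.lt_floor_add_one t
    rw [abs_le]
    constructor <;> linarith) v
  rw [add_sub_cancel] at e₁
  have e₂ : mu ^ ⌊t⌋₊ ≤ mu ^ t / mu := by
    rw [← Real.rpow_sub_one hmu.1.ne', ← Real.rpow_natCast]
    exact Real.rpow_le_rpow_of_exponent_ge hmu.1 hmu.2.le (by
      have := Nat.lt_floor_add_one t
      linarith)
  calc q t v ≤ B * q ⌊t⌋₊ v := e₁
    _ ≤ B * ((K₂ * K + C * (1 + K₂ * K)) * ‖v‖ * (mu ^ t / mu)) := by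
      gcongr
      exact (hn _).trans (by gcongr)
    _ = _ := by ring

theorem exists_decaying_lift [FiniteDimensional ℝ T]
    (h : HyperbolicExtension C lam B K c q m P X Vs Vu Ws Wu)
    (hC : 1 ≤ C) (hlam : lam ∈ Ioo (0 : ℝ) 1) (hB : 1 ≤ B) (hK : 1 ≤ K) {w : W} (hw : w ∈ Ws) :
    ∃ v ∈ decaying q, P v = w := by
  obtain ⟨K₂, -, mu, hmu, -, hlift⟩ := exists_lift_bound hC hlam hB hK
  obtain ⟨v, hP, hv⟩ := hlift h w hw
  refine ⟨v, squeeze_zero (fun _ => apply_nonneg _ _) hv ?_, hP⟩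
  simpa using (tendsto_pow_atTop_nhds_zero_of_lt_one hmu.1.le hmu.2).const_mul (K₂ * m 0 w)

/-- For independence, project a vanishing sum to the base: this removes the neutral coefficient and
`P u`, so `u` is vertical and decaying as well as in `Vu`, hence zero. For spanning, lift the three
components of `P v`; the error is vertical and splits into `Vs` and `Vu`. -/
theorem isInternal [FiniteDimensional ℝ T]
    (h : HyperbolicExtension C lam B K c q m P X Vs Vu Ws Wu)
    (hC : 1 ≤ C) (hlam : lam ∈ Ioo (0 : ℝ) 1) (hB : 1 ≤ B) (hK : 1 ≤ K) (hc : 0 < c) :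
    DirectSum.IsInternal ![decaying q, Submodule.span ℝ {X}, decaying (timeReversal q)] := by
  refine isInternal_three ?_ ?_
  · intro s (hs : s ∈ decaying q) x (hx : x ∈ Submodule.span ℝ {X}) u
      (hu : u ∈ decaying (timeReversal q)) hsum
    obtain ⟨a, rfl⟩ := Submodule.mem_span_singleton.1 hx
    have hPu : P u ∈ Wu := h.reverse.map_mem hlam hc hu
    have hPs := h.map_mem_decaying hs
    have hPsum : P s + (a • P X + P u) = 0 := by
      rw [← map_smul, ← map_add, ← map_add, ← add_assoc, hsum, map_zero]
    obtain ⟨rfl, hPu0⟩ := h.eq_zero_of_mem_base (a := a) hlam hc hPu (by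
      rw [eq_neg_of_add_eq_zero_right hPsum]
      exact (decaying m).neg_mem hPs)
    have hsu : s + u = 0 := by simpa using hsum
    have hu0 : u = 0 := by
      refine h.eq_zero_of_mem_fiber hlam hc (h.reverse.mem_of_map_eq_zero hlam hc hu hPu0) ?_
      rw [eq_neg_of_add_eq_zero_right hsu]
      exact (decaying q).neg_mem hs
    subst hu0
    exact ⟨by simpa using hsu, zero_smul _ _, rfl⟩
  · intro v
    obtain ⟨ws, hws, a, wu, hwu, e⟩ := h.exists_add_eq (P v)
    obtain ⟨s, hs, rfl⟩ := h.exists_decaying_lift hC hlam hB hK hws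
    obtain ⟨u, hu, rfl⟩ := h.reverse.exists_decaying_lift hC hlam hB hK hwu
    have : v - (s + a • X + u) ∈ Vs ⊔ Vu := by
      rw [← h.ker_eq, LinearMap.mem_ker, map_sub, ← e]
      simp
    obtain ⟨s', hs', u', hu', e'⟩ := Submodule.mem_sup.1 this
    refine ⟨s + s', (decaying q).add_mem hs (h.vs.le_decaying hlam hs'), a • X,
      Submodule.mem_span_singleton.2 ⟨a, rfl⟩, u + u',
      (decaying (timeReversal q)).add_mem hu (h.vu.le_decaying hlam hu'), ?_⟩
    rw [← sub_eq_zero, ← sub_eq_zero.2 e']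
    abel

end HyperbolicExtension

/-! ### Local bounds on tangent bundles -/

section TangentNorm

open Filter

variable {F : Type*} [NormedAddCommGroup F] [NormedSpace ℝ F]
  {M : Type*} [TopologicalSpace M] [ChartedSpace F M] [IsManifold 𝓘(ℝ, F) 1 M]
  [RiemannianBundle (fun x : M => TangentSpace 𝓘(ℝ, F) x)]
  [IsContinuousRiemannianBundle F (fun x : M => TangentSpace 𝓘(ℝ, F) x)]

theorem continuous_tangent_norm : Continuous fun v : TangentBundle 𝓘(ℝ, F) M => ‖v.2‖ := by
  have h : Continuous fun v : TangentBundle 𝓘(ℝ, F) M => inner ℝ v.2 v.2 :=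
    Continuous.inner_bundle (F := F) (E := fun x : M => TangentSpace 𝓘(ℝ, F) x)
      (b := fun v : TangentBundle 𝓘(ℝ, F) M => v.1) (v := fun v => v.2) (w := fun v => v.2)
      continuous_id continuous_id
  simp only [norm_eq_sqrt_real_inner]
  exact h.sqrt

/-- A fiberwise homogeneous function on the tangent bundle that is continuous at a zero vector is
locally bounded by a multiple of the norm. -/
theorem exists_tangent_bound {Q : Type*} [TopologicalSpace Q]
    (g : Q → TangentBundle 𝓘(ℝ, F) M → ℝ)
    (hg : ∀ (p : Q) (x : M) (a : ℝ) (v : TangentSpace 𝓘(ℝ, F) x),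
      g p ⟨x, a • v⟩ = |a| * g p ⟨x, v⟩) {p₀ : Q} {x₀ : M}
    (hc : ContinuousAt (fun z : Q × TangentBundle 𝓘(ℝ, F) M => g z.1 z.2) (p₀, ⟨x₀, 0⟩)) :
    ∃ K : ℝ, ∀ᶠ z : Q × M in 𝓝 (p₀, x₀), ∀ v : TangentSpace 𝓘(ℝ, F) z.2,
      g z.1 ⟨z.2, v⟩ ≤ K * ‖v‖ := by
  have hg0 : ∀ p x, g p ⟨x, 0⟩ = 0 := fun p x => by simpa using hg p x 0 0
  set e := trivializationAt F (fun x : M => TangentSpace 𝓘(ℝ, F) x) x₀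
  have hx₀ : x₀ ∈ e.baseSet := FiberBundle.mem_baseSet_trivializationAt' x₀
  obtain ⟨C, hC, hCe⟩ := eventually_norm_trivializationAt_lt F
    (fun x : M => TangentSpace 𝓘(ℝ, F) x) x₀
  have hzero : e.toOpenPartialHomeomorph.symm (x₀, 0) = ⟨x₀, 0⟩ := by
    have := e.mk_symm hx₀ (0 : F)
    rw [← this, ← e.symmL_apply (R := ℝ) hx₀, map_zero]
  have hsymm : ContinuousAt (fun z : (Q × M) × F =>
      g z.1.1 (e.toOpenPartialHomeomorph.symm (z.1.2, z.2))) ((p₀, x₀), 0) := by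
    have h₁ : ContinuousAt e.toOpenPartialHomeomorph.symm (x₀, (0 : F)) :=
      e.toOpenPartialHomeomorph.symm.continuousAt (by simpa [e.mem_target] using hx₀)
    have h₂ : ContinuousAt (fun z : (Q × M) × F =>
        (z.1.1, e.toOpenPartialHomeomorph.symm (z.1.2, z.2))) ((p₀, x₀), 0) := by
      refine ContinuousAt.prodMk (by fun_prop) ?_
      exact ContinuousAt.comp (f := fun z : (Q × M) × F => (z.1.2, z.2)) h₁ (by fun_prop)
    refine ContinuousAt.comp (g := fun z : Q × TangentBundle 𝓘(ℝ, F) M => g z.1 z.2) (f := fun z : (Q × M) × F =>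
        (z.1.1, e.toOpenPartialHomeomorph.symm (z.1.2, z.2))) ?_ h₂
    simpa only [hzero] using hc
  have hlt : ∀ᶠ z in 𝓝 (((p₀, x₀), 0) : (Q × M) × F),
      g z.1.1 (e.toOpenPartialHomeomorph.symm (z.1.2, z.2)) < 1 := by
    refine hsymm.eventually (Iio_mem_nhds ?_)
    simp only [hzero, hg0]
    exact one_pos
  rw [nhds_prod_eq] at hlt
  obtain ⟨pa, hpa, pb, hpb, hab⟩ := eventually_prod_iff.1 hlt
  obtain ⟨ε, hε, hball⟩ := Metric.eventually_nhds_iff.1 hpb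
  -- `g < 1` on vectors of coordinate norm below `ε`, and coordinates enlarge norms by at most `C`.
  -- Rescaling `v` to norm `ε / (2 * C)` and using homogeneity gives this constant.
  refine ⟨2 * C / ε, ?_⟩
  have hCe' : ∀ᶠ z : Q × M in 𝓝 (p₀, x₀), ‖e.continuousLinearMapAt ℝ z.2‖ < C :=
    (continuous_snd.tendsto (p₀, x₀)).eventually hCe
  have hbase : ∀ᶠ z : Q × M in 𝓝 (p₀, x₀), z.2 ∈ e.baseSet :=
    (continuous_snd.tendsto (p₀, x₀)).eventually (e.open_baseSet.mem_nhds hx₀)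
  filter_upwards [hpa, hCe', hbase] with z hz hzC hzb v
  by_cases hv : v = 0
  · simp [hv, hg0]
  have hvn : 0 < ‖v‖ := norm_pos_iff.2 hv
  set a : ℝ := ε / (2 * C * ‖v‖)
  have ha : 0 < a := by positivity
  have hw : ‖e.continuousLinearMapAt ℝ z.2 (a • v)‖ < ε := by
    calc ‖e.continuousLinearMapAt ℝ z.2 (a • v)‖
        ≤ ‖e.continuousLinearMapAt ℝ z.2‖ * ‖a • v‖ := ContinuousLinearMap.le_opNorm _ _
      _ ≤ C * (a * ‖v‖) := by
        rw [norm_smul, Real.norm_of_nonneg ha.le]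
        gcongr
      _ = ε / 2 := by simp only [a]; field_simp
      _ < ε := by linarith
  have h1 := hab hz (hball (y := e.continuousLinearMapAt ℝ z.2 (a • v)) (by simpa using hw))
  have hs : e.toOpenPartialHomeomorph.symm (z.2, e.continuousLinearMapAt ℝ z.2 (a • v))
      = ⟨z.2, a • v⟩ := by
    rw [← e.mk_symm hzb, ← e.symmL_apply (R := ℝ) hzb, e.symmL_continuousLinearMapAt hzb]
  simp only [hs, hg, abs_of_pos ha] at h1
  have : g z.1 ⟨z.2, v⟩ < 1 / a := by rwa [lt_div_iff₀' ha]
  refine this.le.trans_eq ?_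
  simp only [a]
  field_simp

end TangentNorm

/-! ### Continuity of tangent maps -/

section TangentMap

variable {F : Type*} [NormedAddCommGroup F] [NormedSpace ℝ F]
  {H : Type*} [TopologicalSpace H] {I : ModelWithCorners ℝ F H}
  {M : Type*} [TopologicalSpace M] [ChartedSpace H M] [IsManifold I 1 M]
  {F' : Type*} [NormedAddCommGroup F'] [NormedSpace ℝ F']
  {H' : Type*} [TopologicalSpace H'] {I' : ModelWithCorners ℝ F' H'}
  {N : Type*} [TopologicalSpace N] [ChartedSpace H' N] [IsManifold I' 1 N]
  {G : Type*} [NormedAddCommGroup G] [NormedSpace ℝ G]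
  {L : Type*} [TopologicalSpace L] {J : ModelWithCorners ℝ G L}
  {Q : Type*} [TopologicalSpace Q] [ChartedSpace L Q] [IsManifold J 1 Q]

theorem ContMDiffOn.continuousOn_tangentMap {f : M → N} {s : Set M} {n : WithTop ℕ∞}
    (hf : ContMDiffOn I I' n f s) (hn : 1 ≤ n) (hs : IsOpen s) :
    ContinuousOn (tangentMap I I' f) (Bundle.TotalSpace.proj ⁻¹' s) := by
  refine (hf.continuousOn_tangentMapWithin hn hs.uniqueMDiffOn).congr fun v hv => ?_
  exact (tangentMapWithin_eq_tangentMap (hs.uniqueMDiffOn _ hv)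
    ((hf.contMDiffAt (hs.mem_nhds hv)).mdifferentiableAt (by
      rintro rfl; simp at hn))).symm

/-- Continuity of the derivative of a map on a product, as a function of pairs of tangent
vectors. -/
theorem ContMDiffOn.continuousOn_mfderiv_prod {f : Q × M → N} {s : Set (Q × M)} {n : WithTop ℕ∞}
    (hf : ContMDiffOn (J.prod I) I' n f s) (hn : 1 ≤ n) (hs : IsOpen s) :
    ContinuousOn (fun z : TangentBundle J Q × TangentBundle I M =>
      (⟨f (z.1.1, z.2.1), mfderiv (J.prod I) I' f (z.1.1, z.2.1) (z.1.2, z.2.2)⟩ :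
        TangentBundle I' N)) {z | (z.1.1, z.2.1) ∈ s} :=
  (hf.continuousOn_tangentMap hn hs).comp
    (contMDiff_equivTangentBundleProd_symm (I := J) (M := Q) (I' := I) (M' := M)
      (n := 0)).continuous.continuousOn fun _ hz => hz

theorem continuous_zero_tangent : Continuous fun x : M => (⟨x, 0⟩ : TangentBundle I M) :=
  Bundle.Trivialization.continuous_zeroSection ℝ

end TangentMap

/-! ### Uniform bounds from local ones -/

section Compactness

/-- A monotone family of properties that holds locally with some constant holds with a uniform
constant on a compact set. -/
theorem IsCompact.exists_uniform_bound {Z : Type*} [TopologicalSpace Z] {S : Set Z}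
    (hS : IsCompact S) {P : ℝ → Z → Prop} (hP : ∀ ⦃a b⦄, a ≤ b → ∀ z, P a z → P b z)
    (hloc : ∀ z ∈ S, ∃ K, ∀ᶠ z' in 𝓝 z, P K z') : ∃ K, ∀ z ∈ S, P K z := by
  refine hS.induction_on (p := fun s => ∃ K, ∀ z ∈ s, P K z) ⟨0, by simp⟩
    (fun s t hst ⟨K, hK⟩ => ⟨K, fun z hz => hK z (hst hz)⟩) ?_ ?_
  · rintro s t ⟨K, hK⟩ ⟨K', hK'⟩
    refine ⟨max K K', fun z hz => hz.elim (fun h => ?_) fun h => ?_⟩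
    · exact hP (le_max_left _ _) z (hK z h)
    · exact hP (le_max_right _ _) z (hK' z h)
  · intro z hz
    obtain ⟨K, hK⟩ := hloc z hz
    exact ⟨_, mem_nhdsWithin_of_mem_nhds hK, K, fun z' hz' => hz'⟩

end Compactness

/-! ### Derivatives of flows and their generators -/

section FlowDerivative

variable {F : Type*} [NormedAddCommGroup F] [NormedSpace ℝ F]
  {H : Type*} [TopologicalSpace H] {I : ModelWithCorners ℝ F H}
  {M : Type*} [TopologicalSpace M] [ChartedSpace H M]
  {r : ℕ∞} {φ : Flow ℝ M}

theorem one_le_coe_of_one_le (hr : 1 ≤ r) : (1 : WithTop ℕ∞) ≤ (r : WithTop ℕ∞) := by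
  exact_mod_cast hr

theorem coe_ne_zero_of_one_le (hr : 1 ≤ r) : (r : WithTop ℕ∞) ≠ 0 := by
  intro h
  have := one_le_coe_of_one_le hr
  simp [h] at this

theorem IsSmoothFlow.mdifferentiable_uncurry (hφ : IsSmoothFlow I r φ) (hr : 1 ≤ r) :
    MDifferentiable (𝓘(ℝ, ℝ).prod I) I (fun q : ℝ × M => φ q.1 q.2) :=
  ContMDiff.mdifferentiable hφ (coe_ne_zero_of_one_le hr)

theorem IsSmoothFlow.mdifferentiable (hφ : IsSmoothFlow I r φ) (hr : 1 ≤ r) (t : ℝ) :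
    MDifferentiable I I (φ t) :=
  (hφ.mdifferentiable_uncurry hr).comp (mdifferentiable_const.prodMk mdifferentiable_id)

theorem IsSmoothFlow.mdifferentiable_orbit (hφ : IsSmoothFlow I r φ) (hr : 1 ≤ r) (x : M) :
    MDifferentiable 𝓘(ℝ, ℝ) I (fun t : ℝ => φ t x) :=
  (hφ.mdifferentiable_uncurry hr).comp (mdifferentiable_id.prodMk mdifferentiable_const)

/-- Writing the derivative of a time-`t` map as a partial derivative of the joint map yields its
continuity in time and vector together. -/
theorem IsSmoothFlow.mfderiv_eq (hφ : IsSmoothFlow I r φ) (hr : 1 ≤ r) (t : ℝ) (x : M)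
    (v : TangentSpace I x) : mfderiv I I (φ t) x v =
      mfderiv (𝓘(ℝ, ℝ).prod I) I (fun q : ℝ × M => φ q.1 q.2) (t, x) ((0 : ℝ), v) := by
  have h := mfderiv_comp (I := I) (I' := 𝓘(ℝ, ℝ).prod I) (I'' := I)
    (g := fun q : ℝ × M => φ q.1 q.2) (f := fun y : M => (t, y)) x
    (hφ.mdifferentiable_uncurry hr _) (mdifferentiableAt_const.prodMk mdifferentiableAt_id)
  rw [mfderiv_prod_right] at h
  exact DFunLike.congr_fun h v

theorem IsSmoothFlow.flowGenerator_eq (hφ : IsSmoothFlow I r φ) (hr : 1 ≤ r) (x : M) :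
    flowGenerator I φ x =
      mfderiv (𝓘(ℝ, ℝ).prod I) I (fun q : ℝ × M => φ q.1 q.2) (0, x) ((1 : ℝ), 0) := by
  have h := mfderiv_comp (I := 𝓘(ℝ, ℝ)) (I' := 𝓘(ℝ, ℝ).prod I) (I'' := I)
    (g := fun q : ℝ × M => φ q.1 q.2) (f := fun s : ℝ => (s, x)) 0
    (hφ.mdifferentiable_uncurry hr _) (mdifferentiableAt_id.prodMk mdifferentiableAt_const)
  rw [mfderiv_prod_left] at h
  exact DFunLike.congr_fun h (1 : ℝ)

theorem IsSmoothFlow.continuous_tangentMap [IsManifold I 1 M] (hφ : IsSmoothFlow I r φ)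
    (hr : 1 ≤ r) : Continuous fun z : ℝ × TangentBundle I M => tangentMap I I (φ z.1) z.2 := by
  have h := (ContMDiff.contMDiffOn hφ (s := univ)).continuousOn_mfderiv_prod
    (one_le_coe_of_one_le hr) isOpen_univ
  simp only [mem_univ, ofPred_true, continuousOn_univ] at h
  have h' := h.comp (g := _) (f := fun z : ℝ × TangentBundle I M =>
    ((⟨z.1, 0⟩ : TangentBundle 𝓘(ℝ, ℝ) ℝ), z.2))
    ((continuous_zero_tangent.comp continuous_fst).prodMk continuous_snd)
  convert h' using 1
  funext z
  simp only [tangentMap, Function.comp]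
  rw [hφ.mfderiv_eq hr]
  rfl

theorem IsSmoothFlow.continuous_flowGenerator [IsManifold I 1 M] (hφ : IsSmoothFlow I r φ)
    (hr : 1 ≤ r) : Continuous fun x : M => (⟨x, flowGenerator I φ x⟩ : TangentBundle I M) := by
  have h := (ContMDiff.contMDiffOn hφ (s := univ)).continuousOn_mfderiv_prod
    (one_le_coe_of_one_le hr) isOpen_univ
  simp only [mem_univ, ofPred_true, continuousOn_univ] at h
  have h' := h.comp (g := _) (f := fun x : M =>
    ((⟨0, (1 : ℝ)⟩ : TangentBundle 𝓘(ℝ, ℝ) ℝ), (⟨x, 0⟩ : TangentBundle I M)))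
    (continuous_const.prodMk continuous_zero_tangent)
  convert h' using 1
  funext x
  exact Bundle.TotalSpace.ext (φ.map_zero_apply x).symm (heq_of_eq (hφ.flowGenerator_eq hr x))

theorem IsSmoothFlow.tangentMap_add (hφ : IsSmoothFlow I r φ) (hr : 1 ≤ r)
    (s t : ℝ) (v : TangentBundle I M) :
    tangentMap I I (φ (s + t)) v = tangentMap I I (φ s) (tangentMap I I (φ t) v) := by
  have : φ (s + t) = φ s ∘ φ t := funext fun x => φ.map_add s t x
  rw [this, tangentMap_comp_at _ (hφ.mdifferentiable hr s _) (hφ.mdifferentiable hr t _)]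

theorem tangentMap_flow_zero (v : TangentBundle I M) : tangentMap I I (φ 0) v = v := by
  rw [φ.map_zero, tangentMap_id]
  rfl

section Semiconjugacy

variable {F' : Type*} [NormedAddCommGroup F'] [NormedSpace ℝ F']
  {H' : Type*} [TopologicalSpace H'] {I' : ModelWithCorners ℝ F' H'}
  {E : Type*} [TopologicalSpace E] [ChartedSpace H' E] {Φ : Flow ℝ E} {p : E → M}

/-- This is the semiconjugacy differentiated at time `0`. It makes the generator upstairs nonzero
wherever the one downstairs is. -/
theorem mfderiv_flowGenerator (hΦ : IsSmoothFlow I' r Φ) (hr : 1 ≤ r)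
    (hp : MDifferentiable I' I p) (h : ∀ t y, p (Φ t y) = φ t (p y)) (y : E) :
    mfderiv I' I p y (flowGenerator I' Φ y) = flowGenerator I φ (p y) := by
  -- `Φ 0 y` and `y` are only propositionally equal, so the base point is generalized before the
  -- chain rule is applied.
  have key : ∀ y', Φ 0 y = y' → (mfderiv I' I p y').comp
      (mfderiv 𝓘(ℝ, ℝ) I' (fun t : ℝ => Φ t y) 0) = mfderiv 𝓘(ℝ, ℝ) I (fun t : ℝ => φ t (p y)) 0 := by
    rintro y' rfl
    rw [← mfderiv_comp (I' := I') (0 : ℝ) (hp _) (hΦ.mdifferentiable_orbit hr y 0)]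
    congr 1
    funext t
    exact h t y
  exact DFunLike.congr_fun (key y (Φ.map_zero_apply y)) (1 : ℝ)

theorem tangentMap_semiconj (hφ : IsSmoothFlow I r φ) (hΦ : IsSmoothFlow I' r Φ) (hr : 1 ≤ r)
    (hp : MDifferentiable I' I p) (h : ∀ t y, p (Φ t y) = φ t (p y)) (t : ℝ)
    (v : TangentBundle I' E) : tangentMap I' I p (tangentMap I' I' (Φ t) v) =
      tangentMap I I (φ t) (tangentMap I' I p v) := by
  rw [← tangentMap_comp_at _ (hp _) (hΦ.mdifferentiable hr t _),
    ← tangentMap_comp_at _ (hφ.mdifferentiable hr t _) (hp _)]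
  congr 1
  funext y
  exact h t y

end Semiconjugacy

theorem IsSmoothFlow.mfderiv_flowGenerator (hφ : IsSmoothFlow I r φ) (hr : 1 ≤ r) (t : ℝ)
    (x : M) : mfderiv I I (φ t) x (flowGenerator I φ x) = flowGenerator I φ (φ t x) :=
  _root_.mfderiv_flowGenerator hφ hr (hφ.mdifferentiable hr t)
    (fun s y => by rw [← φ.map_add, ← φ.map_add, add_comm]) x

end FlowDerivative

/-! ### Norms of derivatives along orbits -/

section FlowNorm

variable {F : Type*} [NormedAddCommGroup F] [NormedSpace ℝ F]
  {M : Type*} [TopologicalSpace M] [ChartedSpace F M]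
  [RiemannianBundle (fun x : M => TangentSpace 𝓘(ℝ, F) x)]
  {r : ℕ∞} {φ : Flow ℝ M}

/-- The norms `‖Dφ^t v‖` on the tangent space at a point, as a family of seminorms. -/
noncomputable def derivSeminorm (φ : Flow ℝ M) (x : M) (t : ℝ) : Seminorm ℝ (TangentSpace 𝓘(ℝ, F) x) :=
  (normSeminorm ℝ (TangentSpace 𝓘(ℝ, F) (φ t x))).comp
    (mfderiv 𝓘(ℝ, F) 𝓘(ℝ, F) (φ t) x).toLinearMap

theorem derivSeminorm_apply (x : M) (t : ℝ) (v : TangentSpace 𝓘(ℝ, F) x) :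
    derivSeminorm φ x t v = ‖mfderiv 𝓘(ℝ, F) 𝓘(ℝ, F) (φ t) x v‖ := rfl

theorem derivSeminorm_eq (x : M) (t : ℝ) (v : TangentSpace 𝓘(ℝ, F) x) :
    derivSeminorm φ x t v = ‖(tangentMap 𝓘(ℝ, F) 𝓘(ℝ, F) (φ t) ⟨x, v⟩).2‖ := rfl

theorem derivSeminorm_zero (x : M) (v : TangentSpace 𝓘(ℝ, F) x) :
    derivSeminorm φ x 0 v = ‖v‖ := by
  rw [derivSeminorm_eq, tangentMap_flow_zero]

theorem IsSmoothFlow.derivSeminorm_add (hφ : IsSmoothFlow 𝓘(ℝ, F) r φ) (hr : 1 ≤ r) (x : M)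
    (s t : ℝ) (v : TangentSpace 𝓘(ℝ, F) x) : derivSeminorm φ x (s + t) v =
      derivSeminorm φ (φ t x) s (mfderiv 𝓘(ℝ, F) 𝓘(ℝ, F) (φ t) x v) := by
  rw [derivSeminorm_eq, hφ.tangentMap_add hr]
  rfl

/-- By invariance, starting at time `t` amounts to starting at the point `φ t x`. The condition `1 ≤
C` covers `τ = 0`. -/
theorem IsSmoothFlow.contracts (hφ : IsSmoothFlow 𝓘(ℝ, F) r φ) (hr : 1 ≤ r)
    {D : ∀ x : M, Submodule ℝ (TangentSpace 𝓘(ℝ, F) x)} (hD : IsInvariantField 𝓘(ℝ, F) φ D)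
    {C lam : ℝ} (hC : 1 ≤ C) (h : ∀ t > (0 : ℝ), ∀ x, ∀ v ∈ D x,
      ‖mfderiv 𝓘(ℝ, F) 𝓘(ℝ, F) (φ t) x v‖ ≤ C * lam ^ t * ‖v‖) (x : M) :
    Contracts C lam (derivSeminorm φ x) (D x) := by
  intro t τ hτ v hv
  rcases hτ.eq_or_lt with rfl | hτ
  · simpa using le_mul_of_one_le_left (apply_nonneg (derivSeminorm φ x t) v) hC
  · rw [add_comm, hφ.derivSeminorm_add hr]
    exact h τ hτ _ _ (by rw [← hD]; exact Submodule.mem_map_of_mem hv)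

theorem IsSmoothFlow.contracts_reverse (hφ : IsSmoothFlow 𝓘(ℝ, F) r φ) (hr : 1 ≤ r)
    {D : ∀ x : M, Submodule ℝ (TangentSpace 𝓘(ℝ, F) x)} (hD : IsInvariantField 𝓘(ℝ, F) φ D)
    {C lam : ℝ} (hC : 1 ≤ C) (h : ∀ t > (0 : ℝ), ∀ x, ∀ v ∈ D x,
      ‖mfderiv 𝓘(ℝ, F) 𝓘(ℝ, F) (φ (-t)) x v‖ ≤ C * lam ^ t * ‖v‖) (x : M) :
    Contracts C lam (timeReversal (derivSeminorm φ x)) (D x) := by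
  intro t τ hτ v hv
  rcases hτ.eq_or_lt with rfl | hτ
  · simpa using le_mul_of_one_le_left (apply_nonneg (timeReversal (derivSeminorm φ x) t) v) hC
  · simp only [timeReversal]
    rw [neg_add_rev, hφ.derivSeminorm_add hr]
    exact h τ hτ _ _ (by rw [← hD]; exact Submodule.mem_map_of_mem hv)

variable [IsManifold 𝓘(ℝ, F) 1 M] [IsContinuousRiemannianBundle F (fun x : M => TangentSpace 𝓘(ℝ, F) x)]

theorem IsSmoothFlow.continuous_derivSeminorm (hφ : IsSmoothFlow 𝓘(ℝ, F) r φ) (hr : 1 ≤ r) :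
    Continuous fun z : ℝ × TangentBundle 𝓘(ℝ, F) M => derivSeminorm φ z.2.1 z.1 z.2.2 :=
  continuous_tangent_norm.comp (hφ.continuous_tangentMap hr)

theorem IsSmoothFlow.exists_tempered [CompactSpace M] (hφ : IsSmoothFlow 𝓘(ℝ, F) r φ)
    (hr : 1 ≤ r) : ∃ B : ℝ, ∀ B' ≥ B, ∀ x : M,
      Tempered B' (derivSeminorm (F := F) φ x) := by
  obtain ⟨B, hB⟩ := (isCompact_Icc (a := (-1 : ℝ)) (b := 1)).prod (isCompact_univ (X := M))
    |>.exists_uniform_bound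
    (P := fun K z => ∀ v : TangentSpace 𝓘(ℝ, F) z.2, derivSeminorm φ z.2 z.1 v ≤ K * ‖v‖)
    (fun a b hab z h v => (h v).trans (by gcongr)) fun z _ =>
      exists_tangent_bound (fun t v => derivSeminorm φ v.1 t v.2)
        (fun t x a v => by simp [map_smul_eq_mul])
        (hφ.continuous_derivSeminorm hr).continuousAt
  refine ⟨B, fun B' hB' x t τ hτ v => ?_⟩
  rw [add_comm, hφ.derivSeminorm_add hr]
  refine (hB (τ, φ t x) ⟨abs_le.1 hτ, trivial⟩ _).trans ?_
  rw [derivSeminorm_apply]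
  gcongr

theorem IsSmoothFlow.exists_generator_bounds [CompactSpace M] (hφ : IsSmoothFlow 𝓘(ℝ, F) r φ)
    (hr : 1 ≤ r) (hX : ∀ x, flowGenerator 𝓘(ℝ, F) φ x ≠ 0) :
    ∃ c > (0 : ℝ), ∃ K : ℝ, ∀ x, c ≤ ‖flowGenerator 𝓘(ℝ, F) φ x‖ ∧
      ‖flowGenerator 𝓘(ℝ, F) φ x‖ ≤ K := by
  have hc : Continuous fun x => ‖flowGenerator 𝓘(ℝ, F) φ x‖ :=
    continuous_tangent_norm.comp (hφ.continuous_flowGenerator hr)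
  rcases isEmpty_or_nonempty M with hM | hM
  · exact ⟨1, one_pos, 0, fun x => hM.elim x⟩
  obtain ⟨x₀, -, h₀⟩ := isCompact_univ.exists_isMinOn univ_nonempty hc.continuousOn
  obtain ⟨x₁, -, h₁⟩ := isCompact_univ.exists_isMaxOn univ_nonempty hc.continuousOn
  exact ⟨_, norm_pos_iff.2 (hX x₀), _, fun x => ⟨h₀ (mem_univ x), h₁ (mem_univ x)⟩⟩

end FlowNorm

/-! ### Torus bundles: compactness and bounded lifts -/

section TorusBundleGeometry

variable {F : Type*} [NormedAddCommGroup F] [NormedSpace ℝ F]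
  {M : Type*} [TopologicalSpace M] [ChartedSpace F M]
  {F' : Type*} [NormedAddCommGroup F'] [NormedSpace ℝ F']
  {E : Type*} [TopologicalSpace E] [ChartedSpace F' E] {d : ℕ} {p : E → M}

theorem torusMk_surjective (z : StdTorus d) : ∃ θ : Fin d → ℝ, torusMk θ = z := by
  choose θ hθ using fun i => QuotientAddGroup.mk_surjective (z i)
  exact ⟨θ, funext hθ⟩

/-- Over a compact subset of a trivializing open set, the total space is the continuous image of a
product of that set with the compact torus; finitely many such sets cover `M`. -/
theorem IsAffineTorusBundle.compactSpace [CompactSpace M] [T2Space M]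
    (hp : IsAffineTorusBundle 𝓘(ℝ, F) 𝓘(ℝ, F') d p) : CompactSpace E := by
  obtain ⟨-, atlas, hcover, -⟩ := hp
  obtain ⟨C, hC, hsub⟩ : ∃ C : Set E, IsCompact C ∧ p ⁻¹' univ ⊆ C := by
    refine (isCompact_univ (X := M)).induction_on (p := fun s => ∃ C, IsCompact C ∧ p ⁻¹' s ⊆ C)
      ⟨∅, isCompact_empty, by simp⟩
      (fun s t hst ⟨C, hC, h⟩ => ⟨C, hC, (preimage_mono hst).trans h⟩)
      (fun s t ⟨C, hC, h⟩ ⟨C', hC', h'⟩ => ⟨C ∪ C', hC.union hC', by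
        rw [preimage_union]; exact union_subset_union h h'⟩) ?_
    intro x _
    obtain ⟨e, -, hx⟩ := hcover x
    obtain ⟨S, hS, hxS, hSe⟩ := exists_compact_subset e.open_baseSet hx
    refine ⟨S, mem_nhdsWithin_of_mem_nhds (mem_interior_iff_mem_nhds.1 hxS),
      e.toOpenPartialHomeomorph.symm '' (S ×ˢ univ), ?_, ?_⟩
    · refine (hS.prod isCompact_univ).image_of_continuousOn
        (e.toOpenPartialHomeomorph.continuousOn_symm.mono ?_)
      rw [e.target_eq]
      exact prod_mono hSe le_rfl
    · intro y hy
      have hy' : y ∈ e.source := e.mem_source.2 (hSe hy)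
      refine ⟨e y, ⟨?_, trivial⟩, e.toOpenPartialHomeomorph.left_inv hy'⟩
      rw [e.coe_fst hy']
      exact hy
  exact ⟨hC.of_isClosed_subset isClosed_univ hsub⟩

variable [IsManifold 𝓘(ℝ, F) 1 M] [IsManifold 𝓘(ℝ, F') 1 E]
  [RiemannianBundle (fun x : M => TangentSpace 𝓘(ℝ, F) x)]
  [IsContinuousRiemannianBundle F (fun x : M => TangentSpace 𝓘(ℝ, F) x)]
  [RiemannianBundle (fun y : E => TangentSpace 𝓘(ℝ, F') y)]
  [IsContinuousRiemannianBundle F' (fun y : E => TangentSpace 𝓘(ℝ, F') y)]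

/-- The derivative of a `C^1` map on a compact manifold is bounded. -/
theorem ContMDiff.exists_mfderiv_bound [CompactSpace E] {n : WithTop ℕ∞}
    (hp : ContMDiff 𝓘(ℝ, F') 𝓘(ℝ, F) n p) (hn : 1 ≤ n) :
    ∃ K : ℝ, ∀ y, ∀ v : TangentSpace 𝓘(ℝ, F') y, ‖mfderiv 𝓘(ℝ, F') 𝓘(ℝ, F) p y v‖ ≤ K * ‖v‖ := by
  have hc : Continuous fun z : Unit × TangentBundle 𝓘(ℝ, F') E =>
      ‖(tangentMap 𝓘(ℝ, F') 𝓘(ℝ, F) p z.2).2‖ :=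
    continuous_tangent_norm.comp ((hp.continuous_tangentMap hn).comp continuous_snd)
  obtain ⟨K, hK⟩ := (isCompact_univ (X := Unit × E)).exists_uniform_bound
    (P := fun K z => ∀ v : TangentSpace 𝓘(ℝ, F') z.2,
      ‖mfderiv 𝓘(ℝ, F') 𝓘(ℝ, F) p z.2 v‖ ≤ K * ‖v‖)
    (fun a b hab z h v => (h v).trans (by gcongr)) fun z _ =>
      exists_tangent_bound (fun _ v => ‖(tangentMap 𝓘(ℝ, F') 𝓘(ℝ, F) p v).2‖)
        (fun t x a v => by
          change ‖mfderiv 𝓘(ℝ, F') 𝓘(ℝ, F) p x (a • v)‖ = _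
          rw [map_smul, norm_smul]
          rfl)
        hc.continuousAt
  exact ⟨K, fun y v => hK ((), y) trivial v⟩

/-- The derivative of a `C^1` map on a product in the direction of the first factor is locally
bounded. -/
theorem ContMDiffOn.eventually_mfderiv_fst_le {V : Type*} [NormedAddCommGroup V] [NormedSpace ℝ V]
    {f : M × V → E} {s : Set (M × V)} {n : WithTop ℕ∞}
    (hf : ContMDiffOn (𝓘(ℝ, F).prod 𝓘(ℝ, V)) 𝓘(ℝ, F') n f s) (hn : 1 ≤ n) (hs : IsOpen s)
    {q₀ : M × V} (hq₀ : q₀ ∈ s) : ∃ K : ℝ, ∀ᶠ q in 𝓝 q₀, ∀ v : TangentSpace 𝓘(ℝ, F) q.1,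
      ‖mfderiv (𝓘(ℝ, F).prod 𝓘(ℝ, V)) 𝓘(ℝ, F') f q (v, (0 : V))‖ ≤ K * ‖v‖ := by
  have hT : ContinuousOn (fun z : V × TangentBundle 𝓘(ℝ, F) M =>
      (⟨f (z.2.1, z.1), mfderiv (𝓘(ℝ, F).prod 𝓘(ℝ, V)) 𝓘(ℝ, F') f (z.2.1, z.1)
        (z.2.2, (0 : V))⟩ : TangentBundle 𝓘(ℝ, F') E)) {z | (z.2.1, z.1) ∈ s} :=
    (hf.continuousOn_mfderiv_prod hn hs).comp
      (f := fun z : V × TangentBundle 𝓘(ℝ, F) M => (z.2, (⟨z.1, 0⟩ : TangentBundle 𝓘(ℝ, V) V)))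
      (continuous_snd.prodMk (continuous_zero_tangent.comp continuous_fst)).continuousOn
      fun z hz => hz
  have hopen : IsOpen {z : V × TangentBundle 𝓘(ℝ, F) M | (z.2.1, z.1) ∈ s} :=
    hs.preimage (((FiberBundle.continuous_proj F
      (fun x : M => TangentSpace 𝓘(ℝ, F) x)).comp continuous_snd).prodMk continuous_fst)
  have hcont := continuous_tangent_norm.comp_continuousOn hT
  obtain ⟨K, hK⟩ := exists_tangent_bound (M := M)
    (fun (θ : V) v => ‖mfderiv (𝓘(ℝ, F).prod 𝓘(ℝ, V)) 𝓘(ℝ, F') f (v.1, θ) (v.2, (0 : V))‖)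
    (fun θ x a v => by
      have h : mfderiv (𝓘(ℝ, F).prod 𝓘(ℝ, V)) 𝓘(ℝ, F') f (x, θ) (a • v, (0 : V))
          = a • mfderiv (𝓘(ℝ, F).prod 𝓘(ℝ, V)) 𝓘(ℝ, F') f (x, θ) (v, (0 : V)) :=
        (congrArg (mfderiv (𝓘(ℝ, F).prod 𝓘(ℝ, V)) 𝓘(ℝ, F') f (x, θ))
          (Prod.ext rfl (smul_zero a).symm : ((a • v, (0 : V)) : F × V) = a • (v, (0 : V)))).trans
          ((mfderiv (𝓘(ℝ, F).prod 𝓘(ℝ, V)) 𝓘(ℝ, F') f (x, θ)).map_smul a (v, (0 : V)))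
      exact (congrArg norm h).trans (norm_smul a _))
    (p₀ := q₀.2) (x₀ := q₀.1) (hcont.continuousAt (hopen.mem_nhds hq₀))
  exact ⟨K, (continuous_swap.tendsto q₀).eventually hK⟩

/-- Compose a trivialization with `ℝ^d → 𝕋^d` to get a local diffeomorphism `f` with `p ∘ f =
Prod.fst`; the lift of `w` is the image of `(w, 0)` under the derivative of `f`. Taking `w` in the
tangent bundle avoids transport between the fibers over `p (f q)` and `q.1`. -/
theorem IsAffineTorusBundle.eventually_exists_lift
    (hp : IsAffineTorusBundle 𝓘(ℝ, F) 𝓘(ℝ, F') d p) (y₀ : E) :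
    ∃ K : ℝ, ∀ᶠ y in 𝓝 y₀, ∀ w : TangentBundle 𝓘(ℝ, F) M, w.1 = p y →
      ∃ v : TangentSpace 𝓘(ℝ, F') y, (⟨p y, mfderiv 𝓘(ℝ, F') 𝓘(ℝ, F) p y v⟩ :
        TangentBundle 𝓘(ℝ, F) M) = w ∧ ‖v‖ ≤ K * ‖w.2‖ := by
  obtain ⟨hps, atlas, hcover, hsmooth, -⟩ := hp
  obtain ⟨e, heA, hx₀⟩ := hcover (p y₀)
  obtain ⟨θ₀, hθ₀⟩ := torusMk_surjective (e y₀).2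
  set f : M × (Fin d → ℝ) → E := fun q => e.toOpenPartialHomeomorph.symm (q.1, torusMk q.2)
  have hy₀ : y₀ ∈ e.source := e.mem_source.2 hx₀
  have hf₀ : f (p y₀, θ₀) = y₀ := by
    simp only [f, hθ₀, ← e.coe_fst hy₀]
    exact e.toOpenPartialHomeomorph.left_inv hy₀
  obtain ⟨Ψ, hΨ₀, hΨ⟩ := hsmooth e heA ⟨(p y₀, θ₀), ⟨hx₀, trivial⟩⟩
  set s : Set (M × (Fin d → ℝ)) := Ψ.source ∩ e.baseSet ×ˢ univ
  have hs : IsOpen s := Ψ.open_source.inter (e.open_baseSet.prod isOpen_univ)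
  have hs₀ : (p y₀, θ₀) ∈ s := ⟨hΨ₀, hx₀, trivial⟩
  have hfs : ContMDiffOn (𝓘(ℝ, F).prod 𝓘(ℝ, Fin d → ℝ)) 𝓘(ℝ, F') ∞ f s :=
    (Ψ.contMDiffOn_toFun.congr hΨ).mono inter_subset_left
  have hpf : ∀ q ∈ s, p (f q) = q.1 := fun q hq => by
    have : (q.1, torusMk q.2) ∈ e.target := e.mem_target.2 hq.2.1
    exact e.proj_symm_apply this
  obtain ⟨K, hK⟩ := hfs.eventually_mfderiv_fst_le (by simp) hs hs₀
  have hK' : ∀ᶠ q : M × (Fin d → ℝ) in 𝓝 (p y₀, θ₀), q ∈ s ∧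
      ∀ v : TangentSpace 𝓘(ℝ, F) q.1,
        ‖mfderiv (𝓘(ℝ, F).prod 𝓘(ℝ, Fin d → ℝ)) 𝓘(ℝ, F') f q (v, (0 : Fin d → ℝ))‖ ≤ K * ‖v‖ :=
    Filter.Eventually.and (hs.mem_nhds hs₀) hK
  refine ⟨K, ?_⟩
  have hΨy : Ψ (p y₀, θ₀) = y₀ := (hΨ hΨ₀).symm.trans hf₀
  have hy₀t : y₀ ∈ Ψ.target := hΨy ▸ Ψ.map_source' hΨ₀
  have hinv : Filter.Tendsto Ψ.invFun (𝓝 y₀) (𝓝 (p y₀, θ₀)) := by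
    have := (Ψ.contMDiffOn_invFun.continuousOn).continuousAt (Ψ.open_target.mem_nhds hy₀t)
    have h₂ : Ψ.invFun y₀ = (p y₀, θ₀) := by
      conv_lhs => rw [← hΨy]
      exact Ψ.left_inv' hΨ₀
    rw [← h₂]
    exact this
  filter_upwards [hinv.eventually hK', Ψ.open_target.mem_nhds hy₀t] with y hy hyt
  obtain ⟨q, hq⟩ : ∃ q, q = Ψ.invFun y := ⟨_, rfl⟩
  rw [← hq] at hy
  have hfq : f q = y := by
    refine (hΨ hy.1.1).trans ?_
    rw [hq]
    exact Ψ.right_inv' hyt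
  subst hfq
  rintro ⟨x, w⟩ (rfl : x = p (f q))
  have he : (⟨p (f q), w⟩ : TangentBundle 𝓘(ℝ, F) M) = ⟨q.1, w⟩ :=
    Bundle.TotalSpace.ext (hpf q hy.1) (heq_of_eq rfl)
  refine ⟨mfderiv (𝓘(ℝ, F).prod 𝓘(ℝ, Fin d → ℝ)) 𝓘(ℝ, F') f q (w, (0 : Fin d → ℝ)), ?_, ?_⟩
  · have hchain := mfderiv_comp (I' := 𝓘(ℝ, F')) q (hps.mdifferentiable (by simp) (f q))
      ((hfs.contMDiffAt (hs.mem_nhds hy.1)).mdifferentiableAt (by simp))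
    have hfst : p ∘ f =ᶠ[𝓝 q] Prod.fst := by
      filter_upwards [hs.mem_nhds hy.1] with q' hq' using hpf q' hq'
    have hD : ∀ g : M × (Fin d → ℝ) → M, g =ᶠ[𝓝 q] Prod.fst →
        (⟨g q, mfderiv (𝓘(ℝ, F).prod 𝓘(ℝ, Fin d → ℝ)) 𝓘(ℝ, F) g q (w, (0 : Fin d → ℝ))⟩ :
          TangentBundle 𝓘(ℝ, F) M) = ⟨q.1, w⟩ := fun g hg => by
      refine Bundle.TotalSpace.ext hg.eq_of_nhds (heq_of_eq ?_)
      have h₁ := hg.mfderiv_eq (I := 𝓘(ℝ, F).prod 𝓘(ℝ, Fin d → ℝ)) (I' := 𝓘(ℝ, F))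
      have h₂ := mfderiv_fst (I := 𝓘(ℝ, F)) (I' := 𝓘(ℝ, Fin d → ℝ)) (x := q)
      exact DFunLike.congr_fun (h₁.trans h₂) (w, (0 : Fin d → ℝ))
    have h₃ := hD _ hfst
    rw [hchain] at h₃
    exact h₃.trans he.symm
  · refine (hy.2 w).trans_eq ?_
    rw [congrArg (fun v : TangentBundle 𝓘(ℝ, F) M => ‖v.2‖) he]

/-- Tangent vectors of the base have uniformly bounded lifts. -/
theorem IsAffineTorusBundle.exists_lift_bound [CompactSpace E]
    (hp : IsAffineTorusBundle 𝓘(ℝ, F) 𝓘(ℝ, F') d p) :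
    ∃ K : ℝ, ∀ y : E, ∀ w : TangentBundle 𝓘(ℝ, F) M, w.1 = p y →
      ∃ v : TangentBundle 𝓘(ℝ, F') E, v.1 = y ∧ tangentMap 𝓘(ℝ, F') 𝓘(ℝ, F) p v = w ∧
        ‖v.2‖ ≤ K * ‖w.2‖ := by
  obtain ⟨K, hK⟩ := (isCompact_univ (X := E)).exists_uniform_bound
    (fun a b hab y h w hw => by
      obtain ⟨v, hv, hle⟩ := h w hw
      exact ⟨v, hv, hle.trans (by gcongr)⟩) fun y _ => hp.eventually_exists_lift y
  refine ⟨K, fun y w hw => ?_⟩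
  obtain ⟨v, hv, hle⟩ := hK y trivial w hw
  exact ⟨⟨y, v⟩, rfl, hv, hle⟩

end TorusBundleGeometry

/-! ### From closed splittings to continuous subbundles -/

section ClosedSubbundles

variable {F : Type*} [NormedAddCommGroup F] [NormedSpace ℝ F]
  {M : Type*} [TopologicalSpace M] [ChartedSpace F M] [IsManifold 𝓘(ℝ, F) 1 M]

/-- A closed field with a closed complement, in a continuous splitting into three summands, is a
continuous subbundle. -/
theorem isContinuousSubbundle_of_isClosed [FiniteDimensional ℝ F]
    {D₀ D₁ D₂ : ∀ x : M, Submodule ℝ (TangentSpace 𝓘(ℝ, F) x)}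
    (h₀ : IsClosed {v : TangentBundle 𝓘(ℝ, F) M | v.2 ∈ D₀ v.1})
    (h₁ : IsClosed {v : TangentBundle 𝓘(ℝ, F) M | v.2 ∈ D₁ v.1})
    (h₂ : IsClosed {v : TangentBundle 𝓘(ℝ, F) M | v.2 ∈ D₂ v.1})
    (hD : ∀ x, DirectSum.IsInternal ![D₀ x, D₁ x, D₂ x]) :
    IsContinuousSubbundle 𝓘(ℝ, F) D₀ := by
  intro x₀
  set e := trivializationAt F (fun x : M => TangentSpace 𝓘(ℝ, F) x) x₀
  have hx₀ : x₀ ∈ e.baseSet := FiberBundle.mem_baseSet_trivializationAt' x₀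
  let L : ∀ y : e.baseSet, F ≃ₗ[ℝ] TangentSpace 𝓘(ℝ, F) (y : M) := fun y =>
    (e.continuousLinearEquivAt ℝ y y.2).symm.toLinearEquiv
  have hL : ∀ (y : e.baseSet) (w : F), (⟨y, L y w⟩ : TangentBundle 𝓘(ℝ, F) M) =
      e.toOpenPartialHomeomorph.symm (y, w) := fun y w => by
    rw [← e.mk_symm y.2]
    rfl
  have hcont : Continuous fun z : e.baseSet × F =>
      (⟨z.1, L z.1 z.2⟩ : TangentBundle 𝓘(ℝ, F) M) := by
    simp only [hL]
    refine e.toOpenPartialHomeomorph.continuousOn_symm.comp_continuous (by fun_prop) fun z => ?_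
    exact e.mem_target.2 z.1.2
  -- In the trivialization, `D' D y` is the preimage of `D y` in the fixed space `F`; closedness is
  -- inherited because `L` is jointly continuous.
  let D' : (∀ x : M, Submodule ℝ (TangentSpace 𝓘(ℝ, F) x)) → e.baseSet → Submodule ℝ F :=
    fun D y => (Submodule.orderIsoMapComap (L y)).symm (D y)
  have hclosed : ∀ D : ∀ x : M, Submodule ℝ (TangentSpace 𝓘(ℝ, F) x),
      IsClosed {v : TangentBundle 𝓘(ℝ, F) M | v.2 ∈ D v.1} → IsClosedField (D' D) :=
    fun D h => h.preimage hcont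
  have hdisj : ∀ x, Disjoint (D₁ x) (D₂ x) := fun x => by
    exact (hD x).submodule_iSupIndep.pairwiseDisjoint (show (1 : Fin 3) ≠ 2 by decide)
  have hcompl : ∀ x, IsCompl (D₀ x) (D₁ x ⊔ D₂ x) := fun x => by
    refine ⟨((hD x).submodule_iSupIndep 0).mono_right (sup_le ?_ ?_), ?_⟩
    · exact le_iSup₂_of_le (f := fun j (_ : j ≠ 0) => ![D₀ x, D₁ x, D₂ x] j) 1 (by decide) le_rfl
    · exact le_iSup₂_of_le (f := fun j (_ : j ≠ 0) => ![D₀ x, D₁ x, D₂ x] j) 2 (by decide) le_rfl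
    · rw [codisjoint_iff, ← sup_assoc, (hD x).sup_three_eq_top]
  obtain ⟨k, s, hs, hev⟩ := (hclosed D₀ h₀).exists_frame (D₂ := fun y => D' D₁ y ⊔ D' D₂ y)
    ((hclosed D₁ h₁).sup (hclosed D₂ h₂) fun y =>
      (hdisj y).map_orderIso (Submodule.orderIsoMapComap (L y)).symm)
    (fun y => by
      simp only [D', ← map_sup]
      exact (Submodule.orderIsoMapComap (L y)).symm.isCompl (hcompl y)) ⟨x₀, hx₀⟩
  classical
  -- The value `0` off the base set plays no role: the neighborhood used lies inside it.
  let S : Fin k → ∀ x : M, TangentSpace 𝓘(ℝ, F) x := fun i x =>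
    if h : x ∈ e.baseSet then L ⟨x, h⟩ (s i ⟨x, h⟩) else 0
  have hS : ∀ (i : Fin k) (y : e.baseSet), S i y = L y (s i y) := fun i y => dif_pos y.2
  refine ⟨_, e.open_baseSet.isOpenMap_subtype_val.image_mem_nhds hev, k, S, fun i => ?_, ?_⟩
  · refine ContinuousOn.mono (s := e.baseSet) ?_ (by rintro _ ⟨y, -, rfl⟩; exact y.2)
    rw [continuousOn_iff_continuous_domRestrict]
    refine (hcont.comp (continuous_id.prodMk (hs i))).congr fun y => ?_
    exact congrArg (Bundle.TotalSpace.mk (y : M)) (hS i y).symm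
  · rintro _ ⟨y, ⟨hy₁, hy₂⟩, rfl⟩
    have hy : (fun i => S i y) = fun i => L y (s i y) := funext fun i => hS i y
    rw [hy]
    refine ⟨hy₁.map' (L y).toLinearMap (L y).ker, ?_⟩
    have : (range fun i => L y (s i y)) = (L y).toLinearMap '' range fun i => s i y := by
      rw [← range_comp]
      rfl
    rw [this, Submodule.span_image, hy₂]
    exact (Submodule.orderIsoMapComap (L y)).apply_symm_apply (D₀ y)

variable [RiemannianBundle (fun x : M => TangentSpace 𝓘(ℝ, F) x)]
  [IsContinuousRiemannianBundle F (fun x : M => TangentSpace 𝓘(ℝ, F) x)]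

/-- Proportionality to `X` is the equality case of the Cauchy–Schwarz inequality, a closed
condition. -/
theorem isClosed_span_singleton {X : ∀ x : M, TangentSpace 𝓘(ℝ, F) x}
    (hX : Continuous fun x : M => (⟨x, X x⟩ : TangentBundle 𝓘(ℝ, F) M)) (hX0 : ∀ x, X x ≠ 0) :
    IsClosed {v : TangentBundle 𝓘(ℝ, F) M | v.2 ∈ Submodule.span ℝ {X v.1}} := by
  have hproj : Continuous fun v : TangentBundle 𝓘(ℝ, F) M => v.1 :=
    FiberBundle.continuous_proj F (fun x : M => TangentSpace 𝓘(ℝ, F) x)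
  have hXv : Continuous fun v : TangentBundle 𝓘(ℝ, F) M =>
      (⟨v.1, X v.1⟩ : TangentBundle 𝓘(ℝ, F) M) := hX.comp hproj
  have h₁ : Continuous fun v : TangentBundle 𝓘(ℝ, F) M => inner ℝ (X v.1) v.2 :=
    Continuous.inner_bundle (F := F) (E := fun x : M => TangentSpace 𝓘(ℝ, F) x)
      (b := fun v : TangentBundle 𝓘(ℝ, F) M => v.1) (v := fun v => X v.1) (w := fun v => v.2)
      hXv continuous_id
  have h₂ : Continuous fun v : TangentBundle 𝓘(ℝ, F) M => ‖X v.1‖ :=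
    continuous_tangent_norm.comp hXv
  have : {v : TangentBundle 𝓘(ℝ, F) M | v.2 ∈ Submodule.span ℝ {X v.1}} =
      {v | ‖inner ℝ (X v.1) v.2‖ = ‖X v.1‖ * ‖v.2‖} := by
    ext v
    rw [mem_ofPred_eq, mem_ofPred_eq, Submodule.mem_span_singleton]
    by_cases hv : v.2 = 0
    · simp [hv]
    · rw [norm_inner_eq_norm_iff (hX0 _) hv]
      constructor
      · rintro ⟨a, ha⟩
        exact ⟨a, by rintro rfl; exact hv (by rw [← ha, zero_smul]), ha.symm⟩
      · rintro ⟨a, -, ha⟩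
        exact ⟨a, ha.symm⟩
  rw [this]
  exact isClosed_eq h₁.norm (h₂.mul continuous_tangent_norm)

end ClosedSubbundles

/-! ### Invariance under the flow -/

section InvariantFields

variable {F : Type*} [NormedAddCommGroup F] [NormedSpace ℝ F]
  {H : Type*} [TopologicalSpace H] {I : ModelWithCorners ℝ F H}
  {M : Type*} [TopologicalSpace M] [ChartedSpace H M] {r : ℕ∞} {φ : Flow ℝ M}

/-- The reverse inclusion follows from the forward one at time `-t`. -/
theorem IsSmoothFlow.isInvariantField (hφ : IsSmoothFlow I r φ) (hr : 1 ≤ r)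
    {D : ∀ x : M, Submodule ℝ (TangentSpace I x)}
    (h : ∀ t x, ∀ v ∈ D x, mfderiv I I (φ t) x v ∈ D (φ t x)) : IsInvariantField I φ D := by
  refine fun t x => le_antisymm ?_ fun v hv => ?_
  · rintro _ ⟨v, hv, rfl⟩
    exact h t x v hv
  · obtain ⟨u, hu⟩ : ∃ u, u = tangentMap I I (φ (-t)) ⟨φ t x, v⟩ := ⟨_, rfl⟩
    have huD : u.2 ∈ D u.1 := by
      rw [hu]
      exact h (-t) _ v hv
    have hut : tangentMap I I (φ t) u = ⟨φ t x, v⟩ := by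
      rw [hu, ← hφ.tangentMap_add hr, add_neg_cancel, tangentMap_flow_zero]
    have hu1 : u.1 = x := by
      rw [hu]
      change φ (-t) (φ t x) = x
      rw [← φ.map_add, neg_add_cancel, φ.map_zero_apply]
    obtain ⟨y, u⟩ := u
    obtain rfl : y = x := hu1
    exact ⟨u, huD, Bundle.TotalSpace.mk_inj.1 hut⟩

end InvariantFields

/-! ### Decaying vectors of a flow -/

section FlowEstimates

open Filter

variable {F : Type*} [NormedAddCommGroup F] [NormedSpace ℝ F]
  {M : Type*} [TopologicalSpace M] [ChartedSpace F M]
  [RiemannianBundle (fun x : M => TangentSpace 𝓘(ℝ, F) x)]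
  {r : ℕ∞} {φ : Flow ℝ M} {Ds Du : ∀ x : M, Submodule ℝ (TangentSpace 𝓘(ℝ, F) x)}

/-- Hyperbolic estimates along invariant fields hold along orbits, with all larger constants. -/
theorem HyperbolicEstimates.exists_contracts (h : HyperbolicEstimates 𝓘(ℝ, F) φ Ds Du)
    (hφ : IsSmoothFlow 𝓘(ℝ, F) r φ) (hr : 1 ≤ r) (hs : IsInvariantField 𝓘(ℝ, F) φ Ds)
    (hu : IsInvariantField 𝓘(ℝ, F) φ Du) :
    ∃ C₀ : ℝ, ∃ lam₀ ∈ Ioo (0 : ℝ) 1, ∀ C ≥ C₀, 1 ≤ C → ∀ lam ≥ lam₀, ∀ x,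
      Contracts C lam (derivSeminorm φ x) (Ds x) ∧
      Contracts C lam (timeReversal (derivSeminorm φ x)) (Du x) := by
  obtain ⟨C₀, hC₀, lam₀, hlam₀, h⟩ := h
  refine ⟨C₀, lam₀, hlam₀, fun C hC hC1 lam hlam x => ⟨?_, ?_⟩⟩
  · refine hφ.contracts hr hs hC1 (fun t ht x v hv => ((h t ht x).1 v hv).trans ?_) x
    have := hlam₀.1.le
    gcongr
  · refine hφ.contracts_reverse hr hu hC1 (fun t ht x v hv => ((h t ht x).2 v hv).trans ?_) x
    have := hlam₀.1.le
    gcongr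

/-- Decay is defined along integers, while invariance under the flow shifts time by a real `a`; an
exponential bound at all positive times bridges the gap. -/
theorem tendsto_seminorm_nat_add {T : Type*} [AddCommGroup T] [Module ℝ T] {q : ℝ → Seminorm ℝ T}
    {v : T} {K mu : ℝ} (hmu : mu ∈ Ioo (0 : ℝ) 1) (h : ∀ t > (0 : ℝ), q t v ≤ K * mu ^ t) (a : ℝ) :
    Tendsto (fun n : ℕ => q (n + a) v) atTop (𝓝 0) := by
  have ht : Tendsto (fun n : ℕ => (n : ℝ) + a) atTop atTop :=
    tendsto_atTop_add_const_right _ _ tendsto_natCast_atTop_atTop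
  refine squeeze_zero' (.of_forall fun _ => apply_nonneg _ _)
    ((ht.eventually_gt_atTop 0).mono fun n hn => h _ hn) ?_
  simpa using ((tendsto_rpow_atTop_of_base_lt_one mu (by linarith [hmu.1]) hmu.2).comp ht).const_mul K

/-- A uniform estimate turns the asymptotic condition into inequalities at each time, which define a
closed set. -/
theorem mem_decaying_iff {T : Type*} [NormedAddCommGroup T] [NormedSpace ℝ T]
    {q : ℝ → Seminorm ℝ T} {K mu : ℝ} (hmu : mu ∈ Ioo (0 : ℝ) 1)
    (h : ∀ v ∈ decaying q, ∀ t > (0 : ℝ), q t v ≤ K * mu ^ t * ‖v‖) (v : T) :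
    v ∈ decaying q ↔ ∀ t > (0 : ℝ), q t v ≤ K * mu ^ t * ‖v‖ := by
  refine ⟨h v, fun hv => ?_⟩
  have := tendsto_seminorm_nat_add (K := K * ‖v‖) hmu
    (fun t ht => (hv t ht).trans_eq (by ring)) 0
  simp only [add_zero] at this
  exact this

theorem IsSmoothFlow.isInvariantField_decaying (hφ : IsSmoothFlow 𝓘(ℝ, F) r φ) (hr : 1 ≤ r)
    {K mu : ℝ} (hmu : mu ∈ Ioo (0 : ℝ) 1)
    (h : ∀ x : M, ∀ v ∈ decaying (derivSeminorm (F := F) φ x), ∀ t > (0 : ℝ),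
      derivSeminorm φ x t v ≤ K * mu ^ t * ‖v‖) :
    IsInvariantField 𝓘(ℝ, F) φ fun x => decaying (derivSeminorm φ x) := by
  refine hφ.isInvariantField hr fun t x v hv => ?_
  have := tendsto_seminorm_nat_add (K := K * ‖v‖) hmu
    (fun t ht => (h x v hv t ht).trans_eq (by ring)) t
  simp only [hφ.derivSeminorm_add hr] at this
  exact this

theorem IsSmoothFlow.isInvariantField_decaying_reverse (hφ : IsSmoothFlow 𝓘(ℝ, F) r φ)
    (hr : 1 ≤ r) {K mu : ℝ} (hmu : mu ∈ Ioo (0 : ℝ) 1)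
    (h : ∀ x : M, ∀ v ∈ decaying (timeReversal (derivSeminorm (F := F) φ x)), ∀ t > (0 : ℝ),
      timeReversal (derivSeminorm φ x) t v ≤ K * mu ^ t * ‖v‖) :
    IsInvariantField 𝓘(ℝ, F) φ fun x => decaying (timeReversal (derivSeminorm φ x)) := by
  refine hφ.isInvariantField hr fun t x v hv => ?_
  have := tendsto_seminorm_nat_add (K := K * ‖v‖) hmu
    (fun t ht => (h x v hv t ht).trans_eq (by ring)) (-t)
  have e : ∀ n : ℕ, -((n : ℝ) + -t) = -n + t := fun n => by ring
  simp only [timeReversal, e, hφ.derivSeminorm_add hr] at this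
  exact this

theorem IsSmoothFlow.isClosed_of_bound [IsManifold 𝓘(ℝ, F) 1 M]
    [IsContinuousRiemannianBundle F (fun x : M => TangentSpace 𝓘(ℝ, F) x)]
    (hφ : IsSmoothFlow 𝓘(ℝ, F) r φ) (hr : 1 ≤ r) {σ b : ℝ → ℝ}
    {D : ∀ x : M, Submodule ℝ (TangentSpace 𝓘(ℝ, F) x)}
    (h : ∀ x v, v ∈ D x ↔ ∀ t > (0 : ℝ), derivSeminorm φ x (σ t) v ≤ b t * ‖v‖) :
    IsClosed {v : TangentBundle 𝓘(ℝ, F) M | v.2 ∈ D v.1} := by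
  have hc : ∀ t, Continuous fun v : TangentBundle 𝓘(ℝ, F) M => derivSeminorm φ v.1 (σ t) v.2 :=
    fun t => (hφ.continuous_derivSeminorm hr).comp
      (f := fun v : TangentBundle 𝓘(ℝ, F) M => (σ t, v)) (by fun_prop)
  have hset : {v : TangentBundle 𝓘(ℝ, F) M | v.2 ∈ D v.1} =
      ⋂ t > (0 : ℝ), {v | derivSeminorm φ v.1 (σ t) v.2 ≤ b t * ‖v.2‖} := by
    ext v
    simp only [mem_iInter]
    exact h v.1 v.2
  rw [hset]
  exact isClosed_iInter fun t => isClosed_iInter fun _ =>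
    isClosed_le (hc t) (continuous_const.mul continuous_tangent_norm)

end FlowEstimates

/-! ### Fiberwise Anosov flows as hyperbolic extensions -/

section FiberwiseAnosov

variable {F : Type*} [NormedAddCommGroup F] [NormedSpace ℝ F]
  {M : Type*} [TopologicalSpace M] [ChartedSpace F M]
  [RiemannianBundle (fun x : M => TangentSpace 𝓘(ℝ, F) x)]
  {F' : Type*} [NormedAddCommGroup F'] [NormedSpace ℝ F']
  {E : Type*} [TopologicalSpace E] [ChartedSpace F' E]
  [RiemannianBundle (fun y : E => TangentSpace 𝓘(ℝ, F') y)]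
  {d : ℕ} {p : E → M} {r : ℕ∞} {φ : Flow ℝ M} {Φ : Flow ℝ E}

/-- Lifts of a tangent vector at all times along an orbit, with uniform bounds. -/
theorem exists_lift_along_orbit (hφ : IsSmoothFlow 𝓘(ℝ, F) r φ) (hΦ : IsSmoothFlow 𝓘(ℝ, F') r Φ)
    (hr : 1 ≤ r) (hp : MDifferentiable 𝓘(ℝ, F') 𝓘(ℝ, F) p) (h : ∀ t y, p (Φ t y) = φ t (p y))
    {K : ℝ} (hK : ∀ y : E, ∀ w : TangentBundle 𝓘(ℝ, F) M, w.1 = p y →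
      ∃ v : TangentBundle 𝓘(ℝ, F') E, v.1 = y ∧ tangentMap 𝓘(ℝ, F') 𝓘(ℝ, F) p v = w ∧
        ‖v.2‖ ≤ K * ‖w.2‖) (y : E) (t : ℝ) (w : TangentSpace 𝓘(ℝ, F) (p y)) :
    ∃ v : TangentSpace 𝓘(ℝ, F') y, mfderiv 𝓘(ℝ, F') 𝓘(ℝ, F) p y v = w ∧
      derivSeminorm Φ y t v ≤ K * derivSeminorm φ (p y) t w := by
  -- Lift the transported vector at `Φ t y` with a uniform bound, then bring the lift back to `y` by
  -- `Φ (-t)`.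
  obtain ⟨v, hv₁, hvp, hvK⟩ := hK (Φ t y) (tangentMap 𝓘(ℝ, F) 𝓘(ℝ, F) (φ t) ⟨p y, w⟩) (h t y).symm
  obtain ⟨u, hu⟩ : ∃ u, u = tangentMap 𝓘(ℝ, F') 𝓘(ℝ, F') (Φ (-t)) v := ⟨_, rfl⟩
  have hu₁ : u.1 = y := by
    rw [hu]
    change Φ (-t) v.1 = y
    rw [hv₁, ← Φ.map_add, neg_add_cancel, Φ.map_zero_apply]
  have hut : tangentMap 𝓘(ℝ, F') 𝓘(ℝ, F') (Φ t) u = v := by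
    rw [hu, ← hΦ.tangentMap_add hr, add_neg_cancel, tangentMap_flow_zero]
  have hup : tangentMap 𝓘(ℝ, F') 𝓘(ℝ, F) p u = ⟨p y, w⟩ := by
    rw [hu, tangentMap_semiconj hφ hΦ hr hp h, hvp, ← hφ.tangentMap_add hr, neg_add_cancel,
      tangentMap_flow_zero]
  obtain ⟨y', u⟩ := u
  obtain rfl : y' = y := hu₁
  refine ⟨u, Bundle.TotalSpace.mk_inj.1 hup, ?_⟩
  rw [derivSeminorm_eq, hut]
  exact hvK

variable [IsManifold 𝓘(ℝ, F) 1 M]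
  [IsContinuousRiemannianBundle F (fun x : M => TangentSpace 𝓘(ℝ, F) x)]
  [IsManifold 𝓘(ℝ, F') 1 E]
  [IsContinuousRiemannianBundle F' (fun y : E => TangentSpace 𝓘(ℝ, F') y)]

/-- The derivative of a fiberwise Anosov flow over an Anosov flow is, along each orbit, a
hyperbolic extension, with uniform constants. -/
theorem exists_hyperbolicExtension [CompactSpace M] [CompactSpace E]
    (hp : IsAffineTorusBundle 𝓘(ℝ, F) 𝓘(ℝ, F') d p) (hr : 1 ≤ r)
    (hφ : IsSmoothFlow 𝓘(ℝ, F) r φ) (hΦ : IsSmoothFlow 𝓘(ℝ, F') r Φ)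
    (h : ∀ t y, p (Φ t y) = φ t (p y)) (hX : ∀ x, flowGenerator 𝓘(ℝ, F) φ x ≠ 0)
    (hX' : ∀ y, flowGenerator 𝓘(ℝ, F') Φ y ≠ 0)
    {Es Eu : ∀ x : M, Submodule ℝ (TangentSpace 𝓘(ℝ, F) x)}
    (hEs : IsInvariantField 𝓘(ℝ, F) φ Es) (hEu : IsInvariantField 𝓘(ℝ, F) φ Eu)
    (hE : ∀ x, DirectSum.IsInternal
      ![Es x, Submodule.span ℝ {flowGenerator 𝓘(ℝ, F) φ x}, Eu x])
    (hEhyp : HyperbolicEstimates 𝓘(ℝ, F) φ Es Eu)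
    {Vs Vu : ∀ y : E, Submodule ℝ (TangentSpace 𝓘(ℝ, F') y)}
    (hVs : IsInvariantField 𝓘(ℝ, F') Φ Vs) (hVu : IsInvariantField 𝓘(ℝ, F') Φ Vu)
    (hV : ∀ y, Vs y ⊔ Vu y = verticalSpace 𝓘(ℝ, F) 𝓘(ℝ, F') p y)
    (hVhyp : HyperbolicEstimates 𝓘(ℝ, F') Φ Vs Vu) :
    ∃ C lam B K c : ℝ, 1 ≤ C ∧ lam ∈ Ioo (0 : ℝ) 1 ∧ 1 ≤ B ∧ 1 ≤ K ∧ 0 < c ∧ ∀ y : E,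
      HyperbolicExtension (T := TangentSpace 𝓘(ℝ, F') y) (W := TangentSpace 𝓘(ℝ, F) (p y))
        C lam B K c (derivSeminorm Φ y) (derivSeminorm φ (p y))
        (mfderiv 𝓘(ℝ, F') 𝓘(ℝ, F) p y).toLinearMap (flowGenerator 𝓘(ℝ, F') Φ y)
        (Vs y) (Vu y) (Es (p y)) (Eu (p y)) := by
  have hpd : MDifferentiable 𝓘(ℝ, F') 𝓘(ℝ, F) p := hp.1.mdifferentiable (by simp)
  obtain ⟨C₁, lam₁, hlam₁, h₁⟩ := hEhyp.exists_contracts hφ hr hEs hEu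
  obtain ⟨C₂, lam₂, hlam₂, h₂⟩ := hVhyp.exists_contracts hΦ hr hVs hVu
  obtain ⟨B, hB⟩ := hΦ.exists_tempered hr
  obtain ⟨K₁, hK₁⟩ := hp.exists_lift_bound
  obtain ⟨K₂, hK₂⟩ := hp.1.exists_mfderiv_bound (by simp)
  obtain ⟨c₁, hc₁, K₃, hK₃⟩ := hφ.exists_generator_bounds hr hX
  obtain ⟨c₂, hc₂, K₄, hK₄⟩ := hΦ.exists_generator_bounds hr hX'
  set C := max 1 (max C₁ C₂)
  set lam := max lam₁ lam₂
  set K := max 1 (max (max K₁ K₂) (max K₃ K₄))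
  have hKK : K₁ ≤ K ∧ K₂ ≤ K ∧ K₃ ≤ K ∧ K₄ ≤ K := by simp [K]
  have hC1 : 1 ≤ C := le_max_left _ _
  have hCC : C₁ ≤ C ∧ C₂ ≤ C := by simp [C]
  refine ⟨C, lam, max 1 B, K, min c₁ c₂, hC1,
    ⟨lt_max_of_lt_left hlam₁.1, max_lt hlam₁.2 hlam₂.2⟩, le_max_left _ _, le_max_left _ _,
    lt_min hc₁ hc₂, fun y => ?_⟩
  have hmap : mfderiv 𝓘(ℝ, F') 𝓘(ℝ, F) p y (flowGenerator 𝓘(ℝ, F') Φ y) =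
    flowGenerator 𝓘(ℝ, F) φ (p y) := mfderiv_flowGenerator hΦ hr hpd h y
  have hfield : ∀ t, derivSeminorm Φ y t (flowGenerator 𝓘(ℝ, F') Φ y) =
      ‖flowGenerator 𝓘(ℝ, F') Φ (Φ t y)‖ := fun t => by
    rw [derivSeminorm_apply, hΦ.mfderiv_flowGenerator hr]
  have hfield' : ∀ t, derivSeminorm φ (p y) t (mfderiv 𝓘(ℝ, F') 𝓘(ℝ, F) p y
      (flowGenerator 𝓘(ℝ, F') Φ y)) = ‖flowGenerator 𝓘(ℝ, F) φ (φ t (p y))‖ := fun t => by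
    rw [hmap, derivSeminorm_apply, hφ.mfderiv_flowGenerator hr]
  constructor
  · exact derivSeminorm_zero y
  · intro w hw
    rwa [derivSeminorm_zero, norm_eq_zero] at hw
  · exact hB _ (le_max_right _ _) y
  · exact (hV y).symm
  · intro t w
    obtain ⟨v, hv, hle⟩ := exists_lift_along_orbit hφ hΦ hr hpd h hK₁ y t w
    exact ⟨v, hv, hle.trans (mul_le_mul_of_nonneg_right hKK.1 (apply_nonneg _ _))⟩
  · intro t v
    have e : derivSeminorm φ (p y) t (mfderiv 𝓘(ℝ, F') 𝓘(ℝ, F) p y v) =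
        ‖mfderiv 𝓘(ℝ, F') 𝓘(ℝ, F) p (Φ t y) (mfderiv 𝓘(ℝ, F') 𝓘(ℝ, F') (Φ t) y v)‖ :=
      congrArg (fun w : TangentBundle 𝓘(ℝ, F) M => ‖w.2‖)
        (tangentMap_semiconj hφ hΦ hr hpd h t ⟨y, v⟩).symm
    refine e.trans_le ((hK₂ _ _).trans ?_)
    exact mul_le_mul_of_nonneg_right hKK.2.1 (norm_nonneg _)
  · exact (h₂ C hCC.2 hC1 lam (le_max_right _ _) y).1
  · exact (h₂ C hCC.2 hC1 lam (le_max_right _ _) y).2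
  · exact (h₁ C hCC.1 hC1 lam (le_max_left _ _) (p y)).1
  · exact (h₁ C hCC.1 hC1 lam (le_max_left _ _) (p y)).2
  · have := (hE (p y)).sup_three_eq_top
    rwa [← hmap] at this
  · exact fun t => (hfield t).symm ▸ (min_le_right _ _).trans (hK₄ _).1
  · exact fun t => (hfield t).symm ▸ (hK₄ _).2.trans hKK.2.2.2
  · exact fun t => (min_le_left _ _).trans ((hK₃ _).1.trans_eq (hfield' t).symm)
  · exact fun t => (hfield' t).trans_le ((hK₃ _).2.trans hKK.2.2.1)

end FiberwiseAnosov

/-! ### The main theorem -/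

theorem proposition2p4
    -- the closed Riemannian manifold `M`
    {F : Type*} [NormedAddCommGroup F] [NormedSpace ℝ F] [FiniteDimensional ℝ F]
    {M : Type*} [TopologicalSpace M] [ChartedSpace F M] [IsManifold 𝓘(ℝ, F) ∞ M]
    [CompactSpace M] [T2Space M]
    [RiemannianBundle (fun x : M => TangentSpace 𝓘(ℝ, F) x)]
    [IsContinuousRiemannianBundle F (fun x : M => TangentSpace 𝓘(ℝ, F) x)]
    -- the Riemannian manifold `E`
    {F' : Type*} [NormedAddCommGroup F'] [NormedSpace ℝ F'] [FiniteDimensional ℝ F']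
    {E : Type*} [TopologicalSpace E] [ChartedSpace F' E] [IsManifold 𝓘(ℝ, F') ∞ E]
    [T2Space E]
    [RiemannianBundle (fun y : E => TangentSpace 𝓘(ℝ, F') y)]
    [IsContinuousRiemannianBundle F' (fun y : E => TangentSpace 𝓘(ℝ, F') y)]
    -- the bundle `p : E → M` and the flows
    (d : ℕ) (p : E → M) (hp : IsAffineTorusBundle 𝓘(ℝ, F) 𝓘(ℝ, F') d p)
    (r : ℕ∞) (hr : 1 ≤ r) (φ : Flow ℝ M) (Φ : Flow ℝ E)
    (hφ : IsAnosovFlow 𝓘(ℝ, F) r φ)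
    (hΦ : IsFiberwiseAnosovFlow 𝓘(ℝ, F) 𝓘(ℝ, F') r p φ Φ) :
    IsAnosovFlow 𝓘(ℝ, F') r Φ := by
  obtain ⟨hφs, hX, Es, Eu, -, -, hEs, hEu, hE, hEhyp⟩ := hφ
  obtain ⟨hΦs, hcomm, Vs, Vu, hVs, hVu, hV, hVhyp⟩ := hΦ
  have : CompactSpace E := hp.compactSpace
  have hX' : ∀ y, flowGenerator 𝓘(ℝ, F') Φ y ≠ 0 := fun y hy => hX (p y) <| by
    rw [← mfderiv_flowGenerator hΦs hr (hp.1.mdifferentiable (by simp)) hcomm y, hy, map_zero]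
  obtain ⟨C, lam, B, K, c, hC, hlam, hB, hK, hc, H⟩ := exists_hyperbolicExtension hp hr hφs hΦs
    hcomm hX hX' hEs hEu hE hEhyp hVs hVu (fun y => (hV y).2) hVhyp
  have hfin : ∀ y : E, FiniteDimensional ℝ (TangentSpace 𝓘(ℝ, F') y) :=
    fun y => inferInstanceAs (FiniteDimensional ℝ F')
  -- `K'` and `mu` are fixed before the point `y` and serve both time directions, which makes the
  -- estimates uniform and the two fields closed.
  obtain ⟨K', hK', mu, hmu, hdecay⟩ :=
    HyperbolicExtension.exists_decay_bound (K := K) hC hlam hB hK hc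
  have hs := fun y => hdecay (H y)
  have hu := fun y => hdecay (H y).reverse
  have hint := fun y => (H y).isInternal hC hlam hB hK hc
  have hint' := fun y => (H y).reverse.isInternal hC hlam hB hK hc
  simp only [timeReversal_timeReversal] at hint'
  have hclosed_s := hΦs.isClosed_of_bound hr (σ := id) fun y => mem_decaying_iff hmu (hs y)
  have hclosed_u := hΦs.isClosed_of_bound hr (σ := Neg.neg) fun y => mem_decaying_iff hmu (hu y)
  have hclosed_X := isClosed_span_singleton (hΦs.continuous_flowGenerator hr) hX'
  refine ⟨hΦs, hX', fun y => decaying (derivSeminorm Φ y),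
    fun y => decaying (timeReversal (derivSeminorm Φ y)),
    isContinuousSubbundle_of_isClosed hclosed_s hclosed_X hclosed_u hint,
    isContinuousSubbundle_of_isClosed hclosed_u hclosed_X hclosed_s hint',
    hΦs.isInvariantField_decaying hr hmu hs, hΦs.isInvariantField_decaying_reverse hr hmu hu,
    hint, K', hK', mu, hmu, fun t ht y => ⟨fun v hv => hs y v hv t ht, fun v hv => hu y v hv t ht⟩⟩
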